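/- **Theorem 1.2.** Let $1<p<1+\sqrt2$ and put $N=\frac{p(p-1)}{1+2p-p^2}>0$. Let $0\le a\le M$ and $r_\pm=M\pm\sqrt{M^2-a^2}$, let $R>3M$, and consider on the Kerr space-time with parameters $(a,M)$ the Cauchy problem $$\Box_K u+|u|^p=0,\qquad u|_{\tilde v=0}=u_0,\qquad \tilde T u|_{\tilde v=0}=u_1 .$$ Here the space-time is described by coordinates $(\tilde v,r,\omega)$, $r>r_0$, $\omega\in\mathbb S^2$, where either $r_-<r_0<r_+$ or $r_0=r_+$. They arise from the ingoing coordinates $v=t+\int\frac{r^2+a^2}{\Delta}dr$, $\phi_+=\phi+\int\frac a\Delta dr$ ($\Delta=r^2-2Mr+a^2$) by smooth radial shifts of $v$ and $\phi_+$, the slices of constant $\tilde v$ are uniformly space-like, $\tilde T$ is a smooth uniformly time-like vector field, and for $r>R$ they are the Boyer–Lindquist coordinates, with $\tilde v=t$ and $\tilde T=\partial_t$. We write $x=r\omega\in\mathbb R^3$. The lifespan $T_*(u_0,u_1)\in[0,\infty]$ is the supremum of all $T>0$ for which the problem has an energy solution $u\in C([0,T);H^1)\cap C^1([0,T);L^2)$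 in $0\le\tilde v<T$, $r>r_0$. For a smooth cutoff $\psi$ with $\psi(r)=0$ for $r<1$ and $\psi(r)=1$ for $r>2$, set $\psi_R(r)=\psi(r/R)$, $\phi_R=1-\psi_{2R}$, $s_d=\frac12-\frac1p$ and $$\|(u_0,u_1)\|_X=\|\phi_R(u_0,u_1)\|_{H^3\times H^2}+\sum_{|\gamma|\le2}\big\|\psi_R(\nabla,\Omega)^\gamma(\nabla u_0,u_1)\big\|_{L^2\cap\dot H^{s_d-1}},$$ where $\Omega$ denotes the rotational vector fields. Let $T_*(\varepsilon)$ be the infimum of $T_*(u_0,u_1)$ over all $(u_0,u_1)\in C_0^\infty(r>r_0)$ with $\|(u_0,u_1)\|_X\le\varepsilon$. Then there are constants $C,\varepsilon_0>0$ such that for every $\varepsilon\in(0,\varepsilon_0)$ there are data $(u_0,u_1)\in C_0^\infty(r>4R)$ with $$\|(u_0,u_1)\|_X\le\varepsilon\qquad\text{and}\qquad T_*(u_0,u_1)\le C\varepsilon^{-N},$$ and consequently $T_*(\varepsilon)\le C\varepsilon^{-N}$. In particular, the rate in the lower bound $T_*(\varepsilon)\ge c\,\varepsilon^{-N}$, known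 for $2<p<1+\sqrt2$ and $0\le a\ll M$, cannot be improved: if $\kappa\in\mathbb R$ and $c>0$ are such that $T_*(\varepsilon)\ge c\,\varepsilon^{-\kappa}$ for all sufficiently small $\varepsilon>0$, then $\kappa\le N$. -/

import Mathlib

open MeasureTheory Set Filter Topology Matrix
open scoped ENNReal ContDiff FourierTransform Distributions

noncomputable section

/-- The spatial slice, in the Cartesian coordinates `x = r ω`, `r = ‖x‖`, `ω ∈ 𝕊²`. -/
abbrev E3 : Type := EuclideanSpace ℝ (Fin 3)

/-! ### The Kerr metric -/

namespace Kerr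

/-- `Δ = r² - 2 M r + a²`. -/
def Delta (a M r : ℝ) : ℝ := r ^ 2 - 2 * M * r + a ^ 2

/-- The outer root `r₊ = M + √(M² - a²)` of `Δ`. -/
def rPlus (a M : ℝ) : ℝ := M + Real.sqrt (M ^ 2 - a ^ 2)

/-- The inner root `r₋ = M - √(M² - a²)` of `Δ`. -/
def rMinus (a M : ℝ) : ℝ := M - Real.sqrt (M ^ 2 - a ^ 2)

/-- The Kerr metric in Boyer–Lindquist coordinates `(t, r, θ, φ)`. -/
def blMetric (a M r θ : ℝ) : Matrix (Fin 4) (Fin 4) ℝ :=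
  let ρsq := r ^ 2 + a ^ 2 * Real.cos θ ^ 2
  let gtt := -(1 - 2 * M * r / ρsq)
  let gtφ := -(2 * M * a * r * Real.sin θ ^ 2 / ρsq)
  let grr := ρsq / Delta a M r
  let gθθ := ρsq
  let gφφ := ((r ^ 2 + a ^ 2) ^ 2 - a ^ 2 * Delta a M r * Real.sin θ ^ 2) / ρsq * Real.sin θ ^ 2
  !![gtt, 0,   0,   gtφ;
     0,   grr, 0,   0;
     0,   0,   gθθ, 0;
     gtφ, 0,   0,   gφφ]

/-- The symmetric product `(α ⊗ β + β ⊗ α) / 2` of two covectors. -/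
def symProd (α β : Fin 4 → ℝ) : Matrix (Fin 4) (Fin 4) ℝ :=
  fun i j => (α i * β j + β i * α j) / 2

/-- The Kerr metric in coordinates `(ṽ, x)` which are regular across the horizon.
Start from the ingoing coordinates `v = t + ∫ (r² + a²)/Δ dr`, `φ₊ = φ + ∫ a/Δ dr`, in which
`ds² = -(1 - 2Mr/ρ²) dv² + 2 dv dr - (4Mar sin²θ/ρ²) dv dφ₊ - 2 a sin²θ dr dφ₊ + ρ² dθ²
  + gφφ dφ₊²`,
and put `dv = dṽ + m(r) dr`, `dφ₊ = dφ + k(r) dr`, `x = r ω`, where `ω ∈ 𝕊²` has the spherical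
coordinates `(θ, φ)`. For `m = (r² + a²)/Δ`, `k = a/Δ` these are the Boyer–Lindquist coordinates,
with `ṽ = t`. All terms are written with the one-forms `dr`, `sin²θ dφ` and the round metric
`dω²` of the unit sphere, which are smooth on the axis of rotation. The index `0` stands for
`ṽ`, the indices `1, 2, 3` for `x`. -/
def metric (a M : ℝ) (m k : ℝ → ℝ) (x : E3) : Matrix (Fin 4) (Fin 4) ℝ :=
  let r := ‖x‖
  let ρsq := r ^ 2 + a ^ 2 * (x 2 / r) ^ 2
  let sinsq := (x 0 ^ 2 + x 1 ^ 2) / r ^ 2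
  let dr : Fin 4 → ℝ := ![0, x 0 / r, x 1 / r, x 2 / r]
  let dv : Fin 4 → ℝ := ![1, 0, 0, 0] + m r • dr
  -- `α = sin²θ dφ`
  let α : Fin 4 → ℝ := ![0, -(x 1) / r ^ 2, x 0 / r ^ 2, 0]
  -- `β = sin²θ dφ₊`
  let β : Fin 4 → ℝ := α + (k r * sinsq) • dr
  -- `dω² = (|dx|² - dr²) / r²`
  let dωsq : Matrix (Fin 4) (Fin 4) ℝ :=
    (r ^ 2)⁻¹ • (Matrix.diagonal ![0, 1, 1, 1] - symProd dr dr)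
  -- `σ = dθ² + sin²θ dφ₊²`
  let σ : Matrix (Fin 4) (Fin 4) ℝ :=
    dωsq + (2 * k r) • symProd α dr + (k r ^ 2 * sinsq) • symProd dr dr
  (-(1 - 2 * M * r / ρsq)) • symProd dv dv + (2 : ℝ) • symProd dv dr
    - (4 * M * a * r / ρsq) • symProd dv β - (2 * a) • symProd dr β
    + ρsq • σ + (a ^ 2 * (1 + 2 * M * r / ρsq)) • symProd β β

/-- The point with spherical coordinates `(r, θ, φ)`. -/
def sphPoint (r θ φ : ℝ) : E3 :=
  !₂[r * (Real.sin θ * Real.cos φ), r * (Real.sin θ * Real.sin φ), r * Real.cos θ]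

/-- The Jacobian of `(ṽ, r, θ, φ) ↦ (ṽ, x)`. -/
def sphJac (r θ φ : ℝ) : Matrix (Fin 4) (Fin 4) ℝ :=
  !![1, 0, 0, 0;
     0, Real.sin θ * Real.cos φ, r * (Real.cos θ * Real.cos φ), -(r * (Real.sin θ * Real.sin φ));
     0, Real.sin θ * Real.sin φ, r * (Real.cos θ * Real.sin φ), r * (Real.sin θ * Real.cos φ);
     0, Real.cos θ, -(r * Real.sin θ), 0]

/-- The Jacobian of `(ṽ, r, θ, φ) ↦ (t, r, θ, φ_BL)`, where `dt = dṽ + (m - (r² + a²)/Δ) dr` and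
`dφ_BL = dφ + (k - a/Δ) dr`. -/
def blJac (a M : ℝ) (m k : ℝ → ℝ) (r : ℝ) : Matrix (Fin 4) (Fin 4) ℝ :=
  !![1, m r - (r ^ 2 + a ^ 2) / Delta a M r, 0, 0;
     0, 1, 0, 0;
     0, 0, 1, 0;
     0, k r - a / Delta a M r, 0, 1]

theorem norm_sphPoint (r θ φ : ℝ) (hr : 0 < r) : ‖sphPoint r θ φ‖ = r := by
  rw [EuclideanSpace.norm_eq, Real.sqrt_eq_iff_mul_self_eq (by positivity) hr.le]
  simp only [sphPoint, Fin.sum_univ_three, Real.norm_eq_abs, sq_abs]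
  simp
  linear_combination (r ^ 2 * Real.sin θ ^ 2) * Real.sin_sq_add_cos_sq φ
    + r ^ 2 * Real.sin_sq_add_cos_sq θ

theorem pullback_symProd (J : Matrix (Fin 4) (Fin 4) ℝ) (α β : Fin 4 → ℝ) :
    Jᵀ * symProd α β * J = symProd (α ᵥ* J) (β ᵥ* J) := by
  ext i j
  simp only [symProd, Matrix.mul_apply, Matrix.transpose_apply, Matrix.vecMul, dotProduct,
    Fin.sum_univ_four]
  ring

/-- Off the horizon `metric` is the pull-back of the Boyer–Lindquist form of the Kerr metric. -/
theorem metric_eq_blMetric (a M : ℝ) (m k : ℝ → ℝ) (r θ φ : ℝ) (hr : 0 < r)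
    (hΔ : Delta a M r ≠ 0) :
    (sphJac r θ φ)ᵀ * metric a M m k (sphPoint r θ φ) * sphJac r θ φ =
      (blJac a M m k r)ᵀ * blMetric a M r θ * blJac a M m k r := by
  have hr0 : r ≠ 0 := hr.ne'
  have hφ := Real.sin_sq_add_cos_sq φ
  have hθ := Real.sin_sq_add_cos_sq θ
  have hρ : r ^ 2 + a ^ 2 * Real.cos θ ^ 2 ≠ 0 := by positivity
  have hx0 : sphPoint r θ φ 0 = r * (Real.sin θ * Real.cos φ) := by simp [sphPoint]
  have hx1 : sphPoint r θ φ 1 = r * (Real.sin θ * Real.sin φ) := by simp [sphPoint]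
  have hx2 : sphPoint r θ φ 2 = r * Real.cos θ := by simp [sphPoint]
  have hdr : ![0, Real.sin θ * Real.cos φ, Real.sin θ * Real.sin φ, Real.cos θ] ᵥ* sphJac r θ φ
      = ![0, 1, 0, 0] := by
    ext i
    fin_cases i <;> simp [Matrix.vecMul, dotProduct, Fin.sum_univ_four, sphJac]
    · linear_combination Real.sin θ ^ 2 * hφ + hθ
    · linear_combination r * Real.sin θ * Real.cos θ * hφ
    · ring
  have hdt : ![1, 0, 0, 0] ᵥ* sphJac r θ φ = ![1, 0, 0, 0] := by
    ext i
    fin_cases i <;> simp [Matrix.vecMul, dotProduct, Fin.sum_univ_four, sphJac]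
  have hα : ![0, -(r * (Real.sin θ * Real.sin φ)) / r ^ 2, r * (Real.sin θ * Real.cos φ) / r ^ 2, 0]
      ᵥ* sphJac r θ φ = ![0, 0, 0, Real.sin θ ^ 2] := by
    ext i
    fin_cases i <;> simp [Matrix.vecMul, dotProduct, Fin.sum_univ_four, sphJac] <;> field_simp
    · ring
    · ring
    · linear_combination Real.sin θ ^ 2 * hφ
  have hE : (sphJac r θ φ)ᵀ * Matrix.diagonal ![0, 1, 1, 1] * sphJac r θ φ
      = Matrix.diagonal ![0, 1, r ^ 2, r ^ 2 * Real.sin θ ^ 2] := by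
    ext i j
    fin_cases i <;> fin_cases j <;>
      simp [Matrix.mul_apply, Fin.sum_univ_four, sphJac, Matrix.diagonal_apply]
    · linear_combination Real.sin θ ^ 2 * hφ + hθ
    · linear_combination r * Real.sin θ * Real.cos θ * hφ
    · ring
    · linear_combination r * Real.sin θ * Real.cos θ * hφ
    · linear_combination r ^ 2 * Real.cos θ ^ 2 * hφ + r ^ 2 * hθ
    · ring
    · ring
    · ring
    · linear_combination r ^ 2 * Real.sin θ ^ 2 * hφ
  have hsin : ((r * (Real.sin θ * Real.cos φ)) ^ 2 + (r * (Real.sin θ * Real.sin φ)) ^ 2) / r ^ 2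
      = Real.sin θ ^ 2 := by
    field_simp
    linear_combination Real.sin θ ^ 2 * hφ
  have hd : ∀ y : ℝ, r * y / r = y := fun y => by field_simp
  simp only [metric, norm_sphPoint r θ φ hr, hx0, hx1, hx2, hsin, hd]
  simp only [Matrix.mul_add, Matrix.mul_sub, Matrix.add_mul, Matrix.sub_mul, Matrix.mul_smul,
    Matrix.smul_mul, pullback_symProd, hE, Matrix.add_vecMul, Matrix.smul_vecMul, hdr, hdt, hα]
  have hc : Real.cos θ ^ 2 = 1 - Real.sin θ ^ 2 := by linear_combination hθ
  unfold blMetric blJac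
  rw [hc] at hρ ⊢
  generalize Real.sin θ = s at *
  have hM : M = (r ^ 2 + a ^ 2 - Delta a M r) / (2 * r) := by
    unfold Delta
    field_simp
    ring
  generalize Delta a M r = D at *
  subst hM
  ext i j
  fin_cases i <;> fin_cases j <;>
    simp [symProd, Matrix.mul_apply, Fin.sum_univ_four] <;> field_simp <;> ring

/-- The set `{r > b}` of the slice. -/
def outside (b : ℝ) : TopologicalSpace.Opens E3 :=
  ⟨{x | b < ‖x‖}, isOpen_lt continuous_const continuous_norm⟩

/-- A regular slicing of the Kerr space-time: a time function `ṽ` (with a co-rotating angle, see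
`metric`) on a region `r > r₀`, with uniformly space-like slices, and a smooth uniformly time-like
field `T̃`; for `r > R` one has the Boyer–Lindquist coordinates, `ṽ = t`, and `T̃ = ∂_t`. -/
structure Slicing (a M R : ℝ) where
  /-- The inner radius, in `(r₋, r₊)` or equal to `r₊`. -/
  r₀ : ℝ
  /-- `dv = dṽ + m(r) dr`. -/
  m : ℝ → ℝ
  /-- `dφ₊ = dφ + k(r) dr`. -/
  k : ℝ → ℝ
  /-- The vector field `T̃` (on the slice `ṽ = 0`). -/
  tvec : E3 → Fin 4 → ℝ
  r₀_mem : (rMinus a M < r₀ ∧ r₀ < rPlus a M) ∨ r₀ = rPlus a M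
  m_smooth : ContDiffOn ℝ ∞ m (Ioi r₀)
  k_smooth : ContDiffOn ℝ ∞ k (Ioi r₀)
  m_far : ∀ r, R < r → m r = (r ^ 2 + a ^ 2) / Delta a M r
  k_far : ∀ r, R < r → k r = a / Delta a M r
  spacelike : ∃ c > 0, ∀ x ∈ outside r₀, ∀ w : Fin 4 → ℝ, w 0 = 0 →
    c * ∑ i, w i ^ 2 ≤ w ⬝ᵥ metric a M m k x *ᵥ w
  tvec_smooth : ContDiffOn ℝ ∞ tvec (outside r₀)
  timelike : ∃ c > 0, ∀ x ∈ outside r₀, tvec x ⬝ᵥ metric a M m k x *ᵥ tvec x ≤ -c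
  tvec_far : ∀ x ∈ outside R, tvec x = ![1, 0, 0, 0]

/-- The partial derivative `∂_i f`. -/
def pd (i : Fin 3) (f : E3 → ℝ) (x : E3) : ℝ := fderiv ℝ f x (EuclideanSpace.single i 1)

namespace Slicing

variable {a M R : ℝ} (S : Slicing a M R)

/-- The inverse metric `g^{αβ}`. -/
def ginv (x : E3) : Matrix (Fin 4) (Fin 4) ℝ := (metric a M S.m S.k x)⁻¹

/-- The density `g^{1/2}` of the volume form, `g = -det (g_{αβ})`. -/
def vol (x : E3) : ℝ := Real.sqrt (-(metric a M S.m S.k x).det)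

/-- `L²(r > r₀)` on a slice. -/
abbrev L2 : Type := Lp ℝ 2 (volume.restrict (outside S.r₀ : Set E3))

/-- The flux `g^{1/2} g^{αβ} ∂_β u` of a function whose derivatives `∂_β u` are `D β`. -/
def flux (D : Fin 4 → E3 → ℝ) (α : Fin 4) (x : E3) : ℝ :=
  S.vol x * ∑ β, S.ginv x α β * D β x

/-- `u` is an energy solution, on `0 ≤ ṽ < T`, `r > r₀`, of the Cauchy problem
`□ u + |u|^p = 0`, `u = u₀` and `T̃ u = u₁` at `ṽ = 0`. Here
`□ u = g^{-1/2} ∂_α (g^{1/2} g^{αβ} ∂_β u)`, and `D 0 = ∂_ṽ u`, `D (i+1) = ∂_i u`. -/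
structure IsSolution (p : ℝ) (u₀ u₁ : E3 → ℝ) (T : ℝ) (u : ℝ → S.L2) (D : Fin 4 → ℝ → S.L2) :
    Prop where
  /-- `u ∈ C¹([0, T); L²)`, with time derivative `D 0`. -/
  hasDeriv : ∀ t ∈ Ico 0 T, HasDerivWithinAt u (D 0 t) (Ico 0 T) t
  /-- `D (i+1)` is the weak spatial derivative `∂_i u`. -/
  weakDeriv : ∀ t ∈ Ico 0 T, ∀ (i : Fin 3) (η : 𝓓(outside S.r₀, ℝ)),
    ∫ x in outside S.r₀, u t x * pd i η x = -∫ x in outside S.r₀, D i.succ t x * η x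
  /-- All first derivatives are continuous in time with values in `L²`. -/
  continuousOn : ∀ α, ContinuousOn (D α) (Ico 0 T)
  /-- The nonlinear term is a distribution. -/
  locallyIntegrable : ∀ t ∈ Ico 0 T,
    LocallyIntegrableOn (fun x => |u t x| ^ p) (outside S.r₀ : Set E3)
  /-- The equation, in weak form in space:
  `∂_ṽ (g^{1/2} g^{0β} ∂_β u) = -∂_i (g^{1/2} g^{iβ} ∂_β u) - g^{1/2} |u|^p`. -/
  equation : ∀ η : 𝓓(outside S.r₀, ℝ), ∀ t ∈ Ico 0 T,
    HasDerivWithinAt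
      (fun s => ∫ x in outside S.r₀, S.flux (fun β => D β s) 0 x * η x)
      ((∫ x in outside S.r₀, ∑ i : Fin 3, S.flux (fun β => D β t) i.succ x * pd i η x)
        - ∫ x in outside S.r₀, S.vol x * |u t x| ^ p * η x)
      (Ico 0 T) t
  initial : ∀ᵐ x ∂(volume.restrict (outside S.r₀ : Set E3)), u 0 x = u₀ x
  initial_deriv : ∀ᵐ x ∂(volume.restrict (outside S.r₀ : Set E3)),
    ∑ α, S.tvec x α * D α 0 x = u₁ x

/-- The lifespan `T_*(u₀, u₁)`: the supremum of all `T > 0` such that the Cauchy problem has a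
solution for `0 ≤ ṽ < T`, `r > r₀`. -/
def lifespan (p : ℝ) (u₀ u₁ : E3 → ℝ) : ℝ≥0∞ :=
  ⨆ (T : ℝ) (_ : 0 < T ∧ ∃ u D, S.IsSolution p u₀ u₁ T u D), ENNReal.ofReal T

end Slicing

/-! ### The norm of the data -/

/-- A smooth cutoff `ψ`, `ψ(r) = 0` for `r < 1` and `ψ(r) = 1` for `r > 2`. -/
def IsCutoff (ψ : ℝ → ℝ) : Prop :=
  ContDiff ℝ ∞ ψ ∧ (∀ r, r < 1 → ψ r = 0) ∧ ∀ r, 2 < r → ψ r = 1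

/-- The norm of `H^k(ℝ³)`, for smooth functions. -/
def hNorm (k : ℕ) (f : E3 → ℝ) : ℝ≥0∞ :=
  ∑ n ∈ Finset.range (k + 1), eLpNorm (iteratedFDeriv ℝ n f) 2 volume

/-- The norm `‖ |ξ|^s f̂ ‖_{L²}` of the homogeneous space `Ḣ^s(ℝ³)`, for integrable functions. -/
def homNorm (s : ℝ) (f : E3 → ℝ) : ℝ≥0∞ :=
  eLpNorm (fun ξ : E3 => ((‖ξ‖ ^ s : ℝ) : ℂ) * 𝓕 (fun x : E3 => (f x : ℂ)) ξ) 2 volume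

/-- The fields `∇ = (∂_1, ∂_2, ∂_3)` and the rotations `Ω = x ∧ ∇`. -/
def field : Fin 3 ⊕ Fin 3 → (E3 → ℝ) → E3 → ℝ
  | .inl i, f => pd i f
  | .inr i, f => fun x => x (i + 1) * pd (i + 2) f x - x (i + 2) * pd (i + 1) f x

/-- `(∇, Ω)^γ f`, for a word `γ` in the fields `∇, Ω`. -/
def fields : List (Fin 3 ⊕ Fin 3) → (E3 → ℝ) → E3 → ℝ
  | [], f => f
  | Z :: γ, f => field Z (fields γ f)

/-- `s_d = 1/2 - 1/p`. -/
def sd (p : ℝ) : ℝ := 1 / 2 - 1 / p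

/-- `∑_{|γ| ≤ 2} ‖ψ_R (∇, Ω)^γ f‖_{L² ∩ Ḣ^{s_d - 1}}`, where `ψ_R(r) = ψ(r / R)`. -/
def farNorm (p : ℝ) (ψ : ℝ → ℝ) (R : ℝ) (f : E3 → ℝ) : ℝ≥0∞ :=
  ∑ n ∈ Finset.range 3, ∑ γ : Fin n → Fin 3 ⊕ Fin 3,
    (eLpNorm (fun x => ψ (‖x‖ / R) * fields (List.ofFn γ) f x) 2 volume
      + homNorm (sd p - 1) (fun x => ψ (‖x‖ / R) * fields (List.ofFn γ) f x))

/-- The norm `‖(u₀, u₁)‖_X`, that is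
`‖φ_R (u₀, u₁)‖_{H³ × H²} + ∑_{|γ| ≤ 2} ‖ψ_R (∇, Ω)^γ (∇ u₀, u₁)‖_{L² ∩ Ḣ^{s_d - 1}}`,
where `φ_R = 1 - ψ_{2R}`. -/
def xNorm (p : ℝ) (ψ : ℝ → ℝ) (R : ℝ) (u₀ u₁ : E3 → ℝ) : ℝ≥0∞ :=
  hNorm 3 (fun x => (1 - ψ (‖x‖ / (2 * R))) * u₀ x)
    + hNorm 2 (fun x => (1 - ψ (‖x‖ / (2 * R))) * u₁ x)
    + ((∑ i : Fin 3, farNorm p ψ R (pd i u₀)) + farNorm p ψ R u₁)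

/-- The lifespan `T_*(ε)` with size `ε`: the infimum of the lifespans for data in
`C_0^∞(r > r₀)` with `‖(u₀, u₁)‖_X ≤ ε`. -/
def Slicing.lifespanOfSize {a M R : ℝ} (S : Slicing a M R) (p : ℝ) (ψ : ℝ → ℝ) (ε : ℝ) : ℝ≥0∞ :=
  ⨅ (u₀ : 𝓓(outside S.r₀, ℝ)) (u₁ : 𝓓(outside S.r₀, ℝ))
    (_ : xNorm p ψ R u₀ u₁ ≤ ENNReal.ofReal ε), S.lifespan p u₀ u₁

end Kerr

end

noncomputable section

/-! ### The inverse Kerr metric and the energy fluxes for r > R. -/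

namespace Kerr

/-! The proof is a test function argument at one large length scale τ. The nonlinearity has a sign,
so pairing the equation with a nonnegative test function and applying Young's inequality bounds the
data from above for as long as the solution exists; data violating the bound force blow-up.

The test function is θ(t) h(r), with both factors living at scale τ and h supported in the shell τ ≤
r ≤ 2τ, inside the Boyer–Lindquist region. There Kerr looks spherically symmetric to it: the radial
direction is orthogonal to the others, and the dt dφ cross term is a rotation derivative, which
disappears against a radial function. Write W = -g^{1/2} g^{00} and L = r⁻² ∂_r Δ ∂_r. Then G = ∫ u
W h satisfies G'' = ∫ u Lh + ∫ g^{1/2} |u|^p h (`integral_spatial_flux`, `integral_time_flux`).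
Neither the horizon, nor trapping, nor finite speed of propagation plays any role.

If θ and h are high powers, the error θ Lh - θ'' W h is O(τ⁻²) (θh)^{1/p}, and Young's inequality
absorbs it into the nonlinear term at the cost of τ^{-2q} per unit volume, q = p/(p-1). Integration
over the shell and over [0, τ] gives θ(0) ∫ u₁ W h ≲ τ^{4-2q} (`data_bound`). Since W is bounded
below, the data u₀ = 0, u₁ = A τ^{1-2q} h with A large contradict this, so the lifespan is at most τ
(`exists_lifespan_le`).

These data are dilates of a fixed profile supported beyond 4R. Their norm is governed by the
Ḣ^{s_d-1} part and is at most B τ^{1+1/p-2/(p-1)} = B τ^{-1/N} (`exists_xNorm_le`). Equating this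
bound with ε yields τ = (B/ε)^N. Sharpness of the rate follows by comparing powers as ε → 0
(`le_of_forall_rpow_le`). -/

theorem vecMul_symProd (v α β : Fin 4 → ℝ) :
    v ᵥ* symProd α β = ((v ⬝ᵥ α) / 2) • β + ((v ⬝ᵥ β) / 2) • α := by
  ext i
  simp only [symProd, vecMul, dotProduct, Fin.sum_univ_four, Pi.add_apply, Pi.smul_apply,
    smul_eq_mul]
  ring

theorem norm_sq_eq (x : E3) : ‖x‖ ^ 2 = x 0 ^ 2 + x 1 ^ 2 + x 2 ^ 2 := by
  simp [EuclideanSpace.norm_sq_eq, Fin.sum_univ_three]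

/-- `ρ² = r² + a² cos² θ`. -/
def rhoSq (a : ℝ) (x : E3) : ℝ := ‖x‖ ^ 2 + a ^ 2 * (x 2 / ‖x‖) ^ 2

theorem rhoSq_pos (a : ℝ) {x : E3} (hx : 0 < ‖x‖) : 0 < rhoSq a x := by
  unfold rhoSq; positivity

/-- The radial vector `r ∂_r`. -/
def radial (x : E3) : Fin 4 → ℝ := ![0, x 0, x 1, x 2]

/-- The generator `∂_φ` of the rotations about the axis. -/
def axial (x : E3) : Fin 4 → ℝ := ![0, -x 1, x 0, 0]

/-- The coefficient `-g^{1/2} g^{00}` for `r > R`. -/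
def lapseWeight (a M : ℝ) (x : E3) : ℝ :=
  ((‖x‖ ^ 2 + a ^ 2) ^ 2 - a ^ 2 * Delta a M ‖x‖ * ((x 0 ^ 2 + x 1 ^ 2) / ‖x‖ ^ 2))
    / (‖x‖ ^ 2 * Delta a M ‖x‖)

/-- In Boyer–Lindquist coordinates dr is orthogonal to dt, dθ, dφ and g_rr = ρ²/Δ. Lowering the
index of r∂_r therefore determines the inverse metric on the radial covector, without inverting a
matrix. -/
theorem radial_vecMul_metric {a M : ℝ} {m k : ℝ → ℝ} {x : E3} (hx : 0 < ‖x‖)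
    (hΔ : Delta a M ‖x‖ ≠ 0) (hm : m ‖x‖ = (‖x‖ ^ 2 + a ^ 2) / Delta a M ‖x‖)
    (hk : k ‖x‖ = a / Delta a M ‖x‖) :
    radial x ᵥ* metric a M m k x = (rhoSq a x / Delta a M ‖x‖) • radial x := by
  have hρ := (rhoSq_pos a hx).ne'
  have hn := norm_sq_eq x
  have hr0 := hx.ne'
  simp only [metric, hm, hk]
  rw [← rhoSq]
  set r := ‖x‖
  set s := (x 0 ^ 2 + x 1 ^ 2) / r ^ 2 with hs
  set dr : Fin 4 → ℝ := ![0, x 0 / r, x 1 / r, x 2 / r] with hdr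
  set dt : Fin 4 → ℝ := ![1, 0, 0, 0] with hdt
  set α : Fin 4 → ℝ := ![0, -(x 1) / r ^ 2, x 0 / r ^ 2, 0] with hα
  have e1 : radial x = r • dr := by
    ext i; fin_cases i <;> simp [radial, hdr] <;> field_simp
  have e2 : dr ⬝ᵥ dr = 1 := by
    simp [hdr, dotProduct, Fin.sum_univ_four]; field_simp; rw [hn]
  have e3 : dr ⬝ᵥ α = 0 := by
    simp [hdr, hα, dotProduct, Fin.sum_univ_four]; field_simp; ring
  have e4 : dr ⬝ᵥ dt = 0 := by
    simp [hdr, hdt, dotProduct, Fin.sum_univ_four]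
  have e5 : dr ᵥ* Matrix.diagonal ![0, 1, 1, 1] = dr := by
    ext i; fin_cases i <;> simp [hdr, vecMul_diagonal]
  have hρs : rhoSq a x = r ^ 2 + a ^ 2 - a ^ 2 * s := by
    change r ^ 2 + a ^ 2 * (x 2 / r) ^ 2 = _
    rw [hs]; field_simp; linear_combination a ^ 2 * (-hn)
  rw [e1, Matrix.smul_vecMul]
  simp only [Matrix.vecMul_add, Matrix.vecMul_sub, Matrix.vecMul_smul, vecMul_symProd, e2, e3, e4,
    e5, dotProduct_add, dotProduct_smul]
  have hM : 2 * M * r = (r ^ 2 + a ^ 2 - Delta a M r) := by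
    unfold Delta; ring
  rw [hρs] at hρ ⊢
  -- M is eliminated in favour of Δ, which is then treated as an independent variable; what remains
  -- is a rational identity.
  rw [show 4 * M * a * r = 2 * a * (2 * M * r) by ring, hM]
  clear hM hρs
  generalize Delta a M r = D at *
  clear_value s
  ext i
  simp only [Pi.add_apply, Pi.sub_apply, Pi.smul_apply, smul_eq_mul]
  field_simp
  ring

/-- The gradient of t lies in the span of ∂_t and ∂_φ. The two coefficients are g^{1/2} g^{tt} and
g^{1/2} g^{tφ}, and the factor on the right is g^{1/2}. -/
theorem time_vecMul_metric {a M : ℝ} {m k : ℝ → ℝ} {x : E3} (hx : 0 < ‖x‖)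
    (hΔ : Delta a M ‖x‖ ≠ 0) (hm : m ‖x‖ = (‖x‖ ^ 2 + a ^ 2) / Delta a M ‖x‖)
    (hk : k ‖x‖ = a / Delta a M ‖x‖) :
    (-lapseWeight a M x) • ![1, 0, 0, 0] ᵥ* metric a M m k x
      + (-(2 * M * a / (‖x‖ * Delta a M ‖x‖))) • axial x ᵥ* metric a M m k x
      = (rhoSq a x / ‖x‖ ^ 2) • ![1, 0, 0, 0] := by
  have hρ := (rhoSq_pos a hx).ne'
  have hn := norm_sq_eq x
  have hr0 := hx.ne'
  simp only [metric, hm, hk, lapseWeight]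
  rw [← rhoSq]
  set r := ‖x‖
  set s := (x 0 ^ 2 + x 1 ^ 2) / r ^ 2 with hs
  set dr : Fin 4 → ℝ := ![0, x 0 / r, x 1 / r, x 2 / r] with hdr
  set dt : Fin 4 → ℝ := ![1, 0, 0, 0] with hdt
  set α : Fin 4 → ℝ := ![0, -(x 1) / r ^ 2, x 0 / r ^ 2, 0] with hα
  have e2 : axial x ⬝ᵥ dr = 0 := by
    simp [hdr, axial, dotProduct, Fin.sum_univ_four]; field_simp; ring
  have e3 : axial x ⬝ᵥ α = s := by
    simp [axial, hα, hs, dotProduct, Fin.sum_univ_four]; field_simp; ring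
  have e4 : axial x ⬝ᵥ dt = 0 := by
    simp [axial, hdt, dotProduct, Fin.sum_univ_four]
  have e5 : axial x ᵥ* Matrix.diagonal ![0, 1, 1, 1] = r ^ 2 • α := by
    ext i; fin_cases i <;> simp [axial, hα, vecMul_diagonal] <;> field_simp
  have f2 : dt ⬝ᵥ dr = 0 := by simp [hdr, hdt, dotProduct, Fin.sum_univ_four]
  have f3 : dt ⬝ᵥ α = 0 := by simp [hdt, hα, dotProduct, Fin.sum_univ_four]
  have f4 : dt ⬝ᵥ dt = 1 := by simp [hdt, dotProduct, Fin.sum_univ_four]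
  have f5 : dt ᵥ* Matrix.diagonal ![0, 1, 1, 1] = 0 := by
    ext i; fin_cases i <;> simp [hdt, vecMul_diagonal]
  have hρs : rhoSq a x = r ^ 2 + a ^ 2 - a ^ 2 * s := by
    change r ^ 2 + a ^ 2 * (x 2 / r) ^ 2 = _
    rw [hs]; field_simp; linear_combination a ^ 2 * (-hn)
  simp only [Matrix.vecMul_add, Matrix.vecMul_sub, Matrix.vecMul_smul,
    vecMul_symProd, e2, e3, e4,
    e5, f2, f3, f4, f5, dotProduct_add, dotProduct_smul]
  have hM : 2 * M * r = (r ^ 2 + a ^ 2 - Delta a M r) := by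
    unfold Delta; ring
  have hM' : 2 * M * a / (r * Delta a M r)
      = a * (r ^ 2 + a ^ 2 - Delta a M r) / (r ^ 2 * Delta a M r) := by
    rw [← hM]; field_simp
  rw [hρs] at hρ ⊢
  rw [hM', show 4 * M * a * r = 2 * a * (2 * M * r) by ring, hM]
  clear hM hρs hM'
  generalize Delta a M r = D at *
  clear_value s dr dt α
  ext i
  simp only [Pi.add_apply, Pi.sub_apply, Pi.smul_apply, smul_eq_mul, Pi.zero_apply]
  field_simp
  ring

theorem exists_sphPoint (x : E3) (hx : 0 < ‖x‖) : ∃ θ φ, sphPoint ‖x‖ θ φ = x := by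
  have hn := norm_sq_eq x
  set z : ℂ := ⟨x 0, x 1⟩ with hz
  have hzn : ‖z‖ ^ 2 = x 0 ^ 2 + x 1 ^ 2 := by
    rw [Complex.sq_norm, Complex.normSq_apply]; ring
  have h2 : |x 2| ≤ ‖x‖ := abs_le_of_sq_le_sq (by nlinarith [sq_nonneg (x 0), sq_nonneg (x 1)]) hx.le
  have h2' := abs_le.1 h2
  have hs : ‖x‖ * Real.sin (Real.arccos (x 2 / ‖x‖)) = ‖z‖ := by
    rw [Real.sin_arccos, ← sq_eq_sq₀ (by positivity) (norm_nonneg _), mul_pow, Real.sq_sqrt, hzn]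
    · field_simp; linarith
    · rw [sub_nonneg, div_pow, div_le_one (by positivity)]
      exact sq_le_sq.2 (h2.trans (le_abs_self _))
  refine ⟨Real.arccos (x 2 / ‖x‖), Complex.arg z, ?_⟩
  ext i
  fin_cases i
  · simp only [sphPoint, ← mul_assoc, hs]
    rw [Complex.norm_mul_cos_arg z]
    rfl
  · simp only [sphPoint, ← mul_assoc, hs]
    rw [Complex.norm_mul_sin_arg z]
    rfl
  · simp only [sphPoint]
    simp
    rw [Real.cos_arccos]
    · field_simp
    · rw [le_div_iff₀ hx]; linarith
    · rw [div_le_one hx]; linarith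

theorem det_sphJac (r θ φ : ℝ) : (sphJac r θ φ).det = r ^ 2 * Real.sin θ := by
  simp [sphJac, Matrix.det_succ_row_zero, Fin.sum_univ_succ, Fin.succAbove]
  have h1 := Real.cos_sq' φ
  have h2 := Real.cos_sq' θ
  linear_combination (r ^ 2 * Real.sin θ) * (Real.cos θ ^ 2 + Real.sin θ ^ 2) * h1
    + r ^ 2 * Real.sin θ * h2

theorem det_blJac (a M : ℝ) (m k : ℝ → ℝ) (r : ℝ) : (blJac a M m k r).det = 1 := by
  simp [blJac, Matrix.det_succ_row_zero, Fin.sum_univ_succ, Fin.succAbove]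

theorem det_blMetric (a M r θ : ℝ) (hr : 0 < r) (hΔ : Delta a M r ≠ 0) :
    (blMetric a M r θ).det = -(r ^ 2 + a ^ 2 * Real.cos θ ^ 2) ^ 2 * Real.sin θ ^ 2 := by
  have hρ : r ^ 2 + a ^ 2 * Real.cos θ ^ 2 ≠ 0 := by positivity
  simp [blMetric, Matrix.det_succ_row_zero, Fin.sum_univ_succ, Fin.succAbove]
  rw [Real.cos_sq'] at hρ ⊢
  have hM : M = (r ^ 2 + a ^ 2 - Delta a M r) / (2 * r) := by
    unfold Delta
    field_simp
    ring
  generalize Delta a M r = D at *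
  subst hM
  field_simp
  ring

/-- Off the axis this is the determinant of the pull-back identity `metric_eq_blMetric`, divided by
sin² θ. On the axis the spherical Jacobian degenerates, so the matrix is expanded directly there. -/
theorem det_metric {a M : ℝ} {m k : ℝ → ℝ} {x : E3} (hx : 0 < ‖x‖)
    (hΔ : Delta a M ‖x‖ ≠ 0) (hm : m ‖x‖ = (‖x‖ ^ 2 + a ^ 2) / Delta a M ‖x‖) :
    (metric a M m k x).det = -(rhoSq a x / ‖x‖ ^ 2) ^ 2 := by
  have hn := norm_sq_eq x
  by_cases haxis : x 0 ^ 2 + x 1 ^ 2 = 0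
  · have h0 : x 0 = 0 := by nlinarith [sq_nonneg (x 0), sq_nonneg (x 1)]
    have h1 : x 1 = 0 := by nlinarith [sq_nonneg (x 0), sq_nonneg (x 1)]
    have hρ : ‖x‖ ^ 2 + a ^ 2 * (x 2 / ‖x‖) ^ 2 ≠ 0 := by positivity
    simp only [h0, h1] at hn
    simp only [rhoSq, metric, h0, h1, hm]
    simp [symProd, Matrix.det_succ_row_zero, Fin.sum_univ_succ, Fin.succAbove, Matrix.diagonal_apply]
    have h2 : x 2 ^ 2 = ‖x‖ ^ 2 := by linarith
    have hM : 2 * M * ‖x‖ = (‖x‖ ^ 2 + a ^ 2 - Delta a M ‖x‖) := by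
      unfold Delta; ring
    rw [hM]
    have hr := hx.ne'
    have hc : x 2 / ‖x‖ = 1 ∨ x 2 / ‖x‖ = -1 := by
      rw [← sq_eq_one_iff, div_pow, h2, div_self (pow_ne_zero 2 hr)]
    generalize ‖x‖ = r at *
    generalize Delta a M r = D at *
    have hρ' : r ^ 2 + a ^ 2 ≠ 0 := by positivity
    rcases hc with hc | hc <;> rw [hc] <;> norm_num <;> field_simp <;> ring
  · obtain ⟨θ, φ, hθφ⟩ := exists_sphPoint x hx
    have h := congrArg Matrix.det (metric_eq_blMetric a M m k ‖x‖ θ φ hx hΔ)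
    rw [hθφ] at h
    simp only [Matrix.det_mul, Matrix.det_transpose, det_sphJac, det_blJac,
      det_blMetric a M _ θ hx hΔ] at h
    have hx2 : x 2 = ‖x‖ * Real.cos θ := by
      conv_lhs => rw [← hθφ]
      simp [sphPoint]
    have hs : Real.sin θ ≠ 0 := by
      intro hs
      apply haxis
      have := Real.sin_sq_add_cos_sq θ
      rw [hs] at this
      rw [hx2, mul_pow] at hn
      nlinarith
    rw [rhoSq, hx2, mul_div_cancel_left₀ _ hx.ne']
    have hr := hx.ne'
    field_simp
    apply mul_left_cancel₀ (pow_ne_zero 2 hs)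
    linear_combination h

/-- From r > 3M one gets 2Mr ≤ 2r²/3. -/
theorem Delta_pos {a M R r : ℝ} (ha : 0 ≤ a) (haM : a ≤ M) (hR : 3 * M < R) (hr : R ≤ r) :
    r ^ 2 / 3 ≤ Delta a M r ∧ 0 < Delta a M r := by
  have h0 : 0 < r := by linarith
  have : r ^ 2 / 3 ≤ Delta a M r := by
    unfold Delta
    nlinarith [sq_nonneg a, mul_le_mul_of_nonneg_left (hR.le.trans hr) h0.le]
  exact ⟨this, lt_of_lt_of_le (by positivity) this⟩

namespace Slicing

variable {a M R : ℝ} (S : Slicing a M R)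

theorem vol_eq (ha : 0 ≤ a) (haM : a ≤ M) (hR : 3 * M < R) {x : E3} (hx : R < ‖x‖) :
    S.vol x = rhoSq a x / ‖x‖ ^ 2 := by
  have h0 : 0 < ‖x‖ := by linarith
  have := rhoSq_pos a h0
  rw [vol, det_metric h0 (Delta_pos ha haM hR hx.le).2.ne' (S.m_far _ hx), neg_neg,
    Real.sqrt_sq (by positivity)]

theorem vecMul_ginv (ha : 0 ≤ a) (haM : a ≤ M) (hR : 3 * M < R) {x : E3} (hx : R < ‖x‖)
    {v w : Fin 4 → ℝ} (h : v ᵥ* metric a M S.m S.k x = w) : w ᵥ* S.ginv x = v := by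
  have h0 : 0 < ‖x‖ := by linarith
  have := (rhoSq_pos a h0).ne'
  rw [← h, ginv, vecMul_vecMul, Matrix.mul_nonsing_inv, vecMul_one]
  rw [det_metric h0 (Delta_pos ha haM hR hx.le).2.ne' (S.m_far _ hx), isUnit_iff_ne_zero]
  simp only [neg_ne_zero]
  positivity

theorem flux_eq_dotProduct (D : Fin 4 → E3 → ℝ) (w : Fin 4 → ℝ) (x : E3) :
    ∑ α, w α * S.flux D α x = S.vol x * ((w ᵥ* S.ginv x) ⬝ᵥ fun β => D β x) := by
  simp only [flux, vecMul, dotProduct, Finset.mul_sum, Finset.sum_mul]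
  rw [Finset.sum_comm]
  exact Finset.sum_congr rfl fun _ _ => Finset.sum_congr rfl fun _ _ => by ring

/-- The flux through spheres, in the exterior region. -/
theorem radial_flux (ha : 0 ≤ a) (haM : a ≤ M) (hR : 3 * M < R) {x : E3} (hx : R < ‖x‖)
    (D : Fin 4 → E3 → ℝ) :
    ∑ i : Fin 3, x i * S.flux D i.succ x
      = Delta a M ‖x‖ / ‖x‖ ^ 2 * ∑ i : Fin 3, x i * D i.succ x := by
  have h0 : 0 < ‖x‖ := by linarith
  have hρ := (rhoSq_pos a h0).ne'
  have hΔ := (Delta_pos ha haM hR hx.le).2.ne'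
  have h1 := radial_vecMul_metric h0 hΔ (S.m_far _ hx) (S.k_far _ hx)
  have h2 := S.vecMul_ginv ha haM hR hx h1
  have h3 : radial x ᵥ* S.ginv x = (Delta a M ‖x‖ / rhoSq a x) • radial x := by
    rw [smul_vecMul] at h2
    nth_rw 2 [← h2]
    rw [smul_smul, div_mul_div_cancel₀ hρ, div_self hΔ, one_smul]
  have h4 := S.flux_eq_dotProduct D (radial x) x
  rw [h3, smul_dotProduct, S.vol_eq ha haM hR hx] at h4
  simp only [radial, Fin.sum_univ_four, dotProduct, smul_eq_mul] at h4
  simp only [Fin.sum_univ_three]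
  simp at h4
  change x 0 * S.flux D 1 x + x 1 * S.flux D 2 x + x 2 * S.flux D 3 x = _
  rw [h4]
  change _ = Delta a M ‖x‖ / ‖x‖ ^ 2 * (x 0 * D 1 x + x 1 * D 2 x + x 2 * D 3 x)
  field_simp

/-- The flux through the slices of constant time, in the exterior region. -/
theorem time_flux (ha : 0 ≤ a) (haM : a ≤ M) (hR : 3 * M < R) {x : E3} (hx : R < ‖x‖)
    (D : Fin 4 → E3 → ℝ) :
    S.flux D 0 x = -lapseWeight a M x * D 0 x
      - 2 * M * a / (‖x‖ * Delta a M ‖x‖) * (x 0 * D 2 x - x 1 * D 1 x) := by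
  have h0 : 0 < ‖x‖ := by linarith
  have hρ := (rhoSq_pos a h0).ne'
  have hΔ := (Delta_pos ha haM hR hx.le).2.ne'
  have h1 := time_vecMul_metric h0 hΔ (S.m_far _ hx) (S.k_far _ hx)
  rw [← smul_vecMul, ← smul_vecMul, ← add_vecMul] at h1
  have h2 := S.vecMul_ginv ha haM hR hx h1
  have h4 := S.flux_eq_dotProduct D ((rhoSq a x / ‖x‖ ^ 2) • ![1, 0, 0, 0]) x
  rw [h2, S.vol_eq ha haM hR hx] at h4
  simp only [axial, Fin.sum_univ_four, dotProduct] at h4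
  simp at h4
  rcases h4 with h4 | h4 | h4
  · rw [h4]; ring
  · exact absurd h4 hρ
  · exact absurd h4 (norm_pos_iff.1 h0)

end Slicing
end Kerr

/-! ### Cutoff powers and pairings with L²-valued curves. -/

theorem ContDiffOn.contDiff_mul_of_tsupport_subset {E : Type*} [NormedAddCommGroup E]
    [NormedSpace ℝ E] {n : WithTop ℕ∞} {f g : E → ℝ} {U : Set E} (hg : ContDiffOn ℝ n g U)
    (hU : IsOpen U) (hf : ContDiff ℝ n f) (h : tsupport f ⊆ U) :
    ContDiff ℝ n fun x => g x * f x := by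
  rw [contDiff_iff_contDiffAt]
  intro x
  by_cases hx : x ∈ tsupport f
  · exact (hg.contDiffAt (hU.mem_nhds (h hx))).mul hf.contDiffAt
  · refine contDiffAt_const (c := 0) |>.congr_of_eventuallyEq ?_
    filter_upwards [notMem_tsupport_iff_eventuallyEq.1 hx] with y hy
    simp [hy]

/-- Two derivatives of χ^(n+2) cost at most two powers of χ. The surviving factor χ^n lets Young's
inequality absorb the differentiated test function even where it vanishes. -/
theorem contDiff_pow_profile {χ : ℝ → ℝ} (hχ : ContDiff ℝ ∞ χ) (hc : HasCompactSupport χ)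
    (h0 : ∀ r, 0 ≤ χ r) (h1 : ∀ r, χ r ≤ 1) (n : ℕ) :
    ∃ (f₁ f₂ : ℝ → ℝ) (C : ℝ), ContDiff ℝ ∞ f₁ ∧ 0 ≤ C ∧
      (∀ r, HasDerivAt (fun r => χ r ^ (n + 2)) (f₁ r) r) ∧ (∀ r, HasDerivAt f₁ (f₂ r) r) ∧
      (∀ r, |f₁ r| ≤ C * χ r ^ n) ∧ ∀ r, |f₂ r| ≤ C * χ r ^ n := by
  have hd : ContDiff ℝ ∞ (deriv χ) := hχ.deriv'
  have hdd : ContDiff ℝ ∞ (deriv (deriv χ)) := hd.deriv'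
  obtain ⟨B, hB⟩ := hc.deriv.exists_bound_of_continuous hd.continuous
  obtain ⟨B', hB'⟩ := hc.deriv.deriv.exists_bound_of_continuous hdd.continuous
  have hB0 : 0 ≤ B := (norm_nonneg _).trans (hB 0)
  have hB0' : 0 ≤ B' := (norm_nonneg _).trans (hB' 0)
  have e0 : ∀ r, HasDerivAt χ (deriv χ r) r := fun r =>
    (hχ.differentiable (by simp) r).hasDerivAt
  have e1 : ∀ r, HasDerivAt (deriv χ) (deriv (deriv χ) r) r := fun r =>
    (hd.differentiable (by simp) r).hasDerivAt
  have hp : ∀ r, χ r ^ (n + 1) ≤ χ r ^ n := fun r =>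
    pow_le_pow_of_le_one (h0 r) (h1 r) (by omega)
  refine ⟨fun r => (n + 2) * χ r ^ (n + 1) * deriv χ r,
    fun r => (n + 2) * ((n + 1) * χ r ^ n * deriv χ r) * deriv χ r
      + (n + 2) * χ r ^ (n + 1) * deriv (deriv χ) r,
    (n + 2) * B + (n + 2) * (n + 1) * B ^ 2 + (n + 2) * B', ?_, by positivity, ?_, ?_, ?_, ?_⟩
  · exact (contDiff_const.mul (hχ.pow _)).mul hd
  · intro r
    refine ((e0 r).fun_pow (n + 2)).congr_deriv ?_
    rw [Nat.add_succ_sub_one]; push_cast; rfl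
  · intro r
    refine ((((e0 r).fun_pow (n + 1)).const_mul ((n : ℝ) + 2)).fun_mul (e1 r)).congr_deriv ?_
    rw [Nat.add_sub_cancel]; push_cast; rfl
  · intro r
    rw [abs_mul, abs_of_nonneg (by have := h0 r; positivity)]
    have := h0 r
    calc (n + 2) * χ r ^ (n + 1) * |deriv χ r| ≤ (n + 2) * χ r ^ n * B := by
          exact mul_le_mul (mul_le_mul_of_nonneg_left (hp r) (by positivity)) (hB r)
            (abs_nonneg _) (by positivity)
      _ ≤ _ := by
          have : 0 ≤ ((n + 2) * (n + 1) * B ^ 2 + (n + 2) * B') * χ r ^ n := by positivity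
          linarith
  · intro r
    have := h0 r
    have k1 : |deriv χ r| ≤ B := hB r
    have k2 : |deriv χ r ^ 2| ≤ B ^ 2 := by rw [abs_pow]; gcongr
    have k3 : |deriv (deriv χ) r| ≤ B' := hB' r
    calc _ = |(n + 2) * (n + 1) * χ r ^ n * deriv χ r ^ 2
          + (n + 2) * χ r ^ (n + 1) * deriv (deriv χ) r| := by ring_nf
      _ ≤ (n + 2) * (n + 1) * χ r ^ n * |deriv χ r ^ 2|
          + (n + 2) * χ r ^ (n + 1) * |deriv (deriv χ) r| := by
        refine (abs_add_le _ _).trans (le_of_eq ?_)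
        rw [abs_mul, abs_mul _ (deriv (deriv χ) r), abs_of_nonneg,
          abs_of_nonneg (a := _ * χ r ^ (n + 1))] <;> positivity
      _ ≤ (n + 2) * (n + 1) * χ r ^ n * B ^ 2 + (n + 2) * χ r ^ n * B' := by
        exact add_le_add (mul_le_mul_of_nonneg_left k2 (by positivity))
          (mul_le_mul (mul_le_mul_of_nonneg_left (hp r) (by positivity)) k3
            (abs_nonneg _) (by positivity))
      _ ≤ _ := by
          have : 0 ≤ ((n + 2) * B) * χ r ^ n := by positivity
          linarith

theorem MeasureTheory.Lp.integrable_mul {α : Type*} [MeasurableSpace α] {μ : Measure α}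
    (f : Lp ℝ 2 μ) {g : α → ℝ} (hg : MemLp g 2 μ) : Integrable (fun x => f x * g x) μ :=
  (Lp.memLp f).integrable_mul hg

/-- Pairing with a fixed L² function is a bounded linear functional, so it commutes with the time
derivative. -/
theorem MeasureTheory.Lp.hasDerivWithinAt_integral_mul {α : Type*} [MeasurableSpace α]
    {μ : Measure α} {u : ℝ → Lp ℝ 2 μ} {u' : Lp ℝ 2 μ} {s : Set ℝ} {t : ℝ}
    (h : HasDerivWithinAt u u' s t) {g : α → ℝ} (hg : MemLp g 2 μ) :
    HasDerivWithinAt (fun s => ∫ x, u s x * g x ∂μ) (∫ x, u' x * g x ∂μ) s t := by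
  have key : ∀ f : Lp ℝ 2 μ, innerSL ℝ (hg.toLp g) f = ∫ x, f x * g x ∂μ := by
    intro f
    rw [innerSL_apply_apply, L2.inner_def]
    refine integral_congr_ae ?_
    filter_upwards [hg.coeFn_toLp] with x hx
    rw [hx]; simp
  have := (innerSL ℝ (hg.toLp g)).hasFDerivAt.comp_hasDerivWithinAt t h
  rw [key] at this
  exact this.congr_of_eventuallyEq (.of_forall fun s => (key (u s)).symm) (key (u t)).symm

/-! ### Radial test functions supported in a shell. -/

namespace Kerr

theorem hasFDerivAt_radial {f : ℝ → ℝ} {f' : ℝ} {x : E3} (hx : x ≠ 0)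
    (hf : HasDerivAt f f' ‖x‖) :
    HasFDerivAt (fun x : E3 => f ‖x‖) ((f' / ‖x‖) • innerSL ℝ x) x := by
  have h1 : HasFDerivAt (fun x : E3 => ‖x‖) (‖x‖⁻¹ • innerSL ℝ x) x := by
    have h2 := (hasStrictFDerivAt_norm_sq x).hasFDerivAt.sqrt (by simpa using hx)
    simp only [Real.sqrt_sq (norm_nonneg _)] at h2
    refine h2.congr_fderiv ?_
    rw [← Nat.cast_smul_eq_nsmul ℝ 2, smul_smul]
    congr 1
    push_cast
    field_simp
  refine (hf.comp_hasFDerivAt x h1).congr_fderiv ?_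
  rw [smul_smul, div_eq_mul_inv]

theorem pd_radial {f : ℝ → ℝ} {f' : ℝ} {x : E3} (hx : x ≠ 0)
    (hf : HasDerivAt f f' ‖x‖) (i : Fin 3) :
    pd i (fun x : E3 => f ‖x‖) x = f' / ‖x‖ * x i := by
  rw [pd, (hasFDerivAt_radial hx hf).fderiv]
  simp [EuclideanSpace.inner_single_right]

theorem pd_radial_mul_coord {f : ℝ → ℝ} {f' : ℝ} {x : E3} (hx : x ≠ 0)
    (hf : HasDerivAt f f' ‖x‖) (i j : Fin 3) :
    pd i (fun x : E3 => f ‖x‖ * x j) x = f' / ‖x‖ * x i * x j + if i = j then f ‖x‖ else 0 := by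
  have h := (hasFDerivAt_radial hx hf).mul (EuclideanSpace.proj (𝕜 := ℝ) j).hasFDerivAt
  have h' : HasFDerivAt (fun x : E3 => f ‖x‖ * x j) _ x := h
  rw [pd, h'.fderiv]
  simp [EuclideanSpace.inner_single_right, eq_comm (a := i)]
  ring

/-- A test function, from a smooth function supported in a shell. -/
def shellTest {f : E3 → ℝ} {b l l' : ℝ} (hf : ContDiff ℝ ∞ f)
    (h : ∀ x, f x ≠ 0 → l ≤ ‖x‖ ∧ ‖x‖ ≤ l') (hb : b < l) : 𝓓(outside b, ℝ) :=
  have hs : tsupport f ⊆ {x | l ≤ ‖x‖ ∧ ‖x‖ ≤ l'} :=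
    closure_minimal h ((isClosed_le continuous_const continuous_norm).inter
      (isClosed_le continuous_norm continuous_const))
  ⟨f, hf, HasCompactSupport.of_support_subset_isCompact (isCompact_closedBall (0 : E3) l')
    fun x hx => by simpa using (h x hx).2, fun _ hx => lt_of_lt_of_le hb (hs hx).1⟩

theorem shell_tsupport_subset {f : E3 → ℝ} {l l' : ℝ}
    (h : ∀ x, f x ≠ 0 → l ≤ ‖x‖ ∧ ‖x‖ ≤ l') : tsupport f ⊆ {x | l ≤ ‖x‖ ∧ ‖x‖ ≤ l'} :=
  closure_minimal h ((isClosed_le continuous_const continuous_norm).inter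
      (isClosed_le continuous_norm continuous_const))

theorem contDiff_radial {f : ℝ → ℝ} {l : ℝ} (hl : 0 < l) (hf : ContDiff ℝ ∞ f)
    (h : ∀ r, f r ≠ 0 → l ≤ r) : ContDiff ℝ ∞ fun x : E3 => f ‖x‖ := by
  rw [contDiff_iff_contDiffAt]
  intro x
  by_cases hx : x = 0
  · refine contDiffAt_const (c := 0) |>.congr_of_eventuallyEq ?_
    have : ∀ᶠ y : E3 in 𝓝 x, ‖y‖ < l :=
      (continuous_norm.tendsto x).eventually (gt_mem_nhds (by simpa [hx] using hl))
    filter_upwards [this] with y hy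
    by_contra hne
    exact absurd (h _ hne) (not_le.2 hy)
  · exact hf.contDiffAt.comp x (contDiffAt_norm ℝ hx)

/-- `h` is smooth with derivatives `h₁`, `h₂`, and supported in `[l, l']`. -/
structure IsShellProfile (h h₁ h₂ : ℝ → ℝ) (l l' : ℝ) : Prop where
  pos : 0 < l
  smooth : ContDiff ℝ ∞ h
  smooth₁ : ContDiff ℝ ∞ h₁
  hasDerivAt : ∀ r, HasDerivAt h (h₁ r) r
  hasDerivAt₁ : ∀ r, HasDerivAt h₁ (h₂ r) r
  supp : ∀ r, h r ≠ 0 → l ≤ r ∧ r ≤ l'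
  supp₁ : ∀ r, h₁ r ≠ 0 → l ≤ r ∧ r ≤ l'

/-- The operator `r⁻² ∂_r Δ ∂_r` on the profile `h` with derivatives `h₁`, `h₂`. -/
def radialWave (a M : ℝ) (h₁ h₂ : ℝ → ℝ) (r : ℝ) : ℝ :=
  (2 * r - 2 * M) / r ^ 2 * h₁ r + Delta a M r / r ^ 2 * h₂ r

theorem continuous_hasCompactSupport_memLp {f : E3 → ℝ} (hf : Continuous f)
    (hc : HasCompactSupport f) (s : Set E3) : MemLp f 2 (volume.restrict s) :=
  (hf.memLp_of_hasCompactSupport hc).restrict s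

theorem Delta_contDiff (a M : ℝ) : ContDiff ℝ ∞ (Delta a M) := by
  unfold Delta; fun_prop

namespace IsShellProfile

variable {h h₁ h₂ : ℝ → ℝ} {l l' : ℝ}

theorem tsupport_subset₁ (H : IsShellProfile h h₁ h₂ l l') : tsupport h₁ ⊆ Ici l :=
  closure_minimal (fun r hr => (H.supp₁ r hr).1) isClosed_Ici

theorem contDiff_norm (H : IsShellProfile h h₁ h₂ l l') :
    ContDiff ℝ ∞ fun x : E3 => h ‖x‖ :=
  contDiff_radial H.pos H.smooth fun r hr => (H.supp r hr).1

/-- Multiplication by a function which is smooth outside a smaller ball. -/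
theorem contDiff_mul (H : IsShellProfile h h₁ h₂ l l') {b : ℝ} (hb : b < l) {g : E3 → ℝ}
    (hg : ContDiffOn ℝ ∞ g {x | b < ‖x‖}) : ContDiff ℝ ∞ fun x : E3 => g x * h ‖x‖ :=
  hg.contDiff_mul_of_tsupport_subset (isOpen_lt continuous_const continuous_norm) H.contDiff_norm
    fun _ hx => lt_of_lt_of_le hb (shell_tsupport_subset (fun x hx => H.supp ‖x‖ hx) hx).1

theorem contDiff_mul₁ (H : IsShellProfile h h₁ h₂ l l') {g : ℝ → ℝ}
    (hg : ContDiffOn ℝ ∞ g (Ioi 0)) : ContDiff ℝ ∞ fun r => g r * h₁ r :=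
  hg.contDiff_mul_of_tsupport_subset isOpen_Ioi H.smooth₁
    fun _ hx => lt_of_lt_of_le H.pos (H.tsupport_subset₁ hx)

theorem contDiff_mul_real (H : IsShellProfile h h₁ h₂ l l') {b : ℝ} (hb : b < l) {g : ℝ → ℝ}
    (hg : ContDiffOn ℝ ∞ g (Ioi b)) : ContDiff ℝ ∞ fun r => g r * h r :=
  hg.contDiff_mul_of_tsupport_subset isOpen_Ioi H.smooth fun _ hx => lt_of_lt_of_le hb
    (closure_minimal (fun r hr => (H.supp r hr).1) isClosed_Ici hx)

theorem hasCompactSupport_mul (H : IsShellProfile h h₁ h₂ l l') (g : E3 → ℝ) :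
    HasCompactSupport fun x : E3 => g x * h ‖x‖ :=
  HasCompactSupport.of_support_subset_isCompact (isCompact_closedBall (0 : E3) l')
    fun x hx => by simpa using (H.supp ‖x‖ (right_ne_zero_of_mul hx)).2

theorem pd_norm (H : IsShellProfile h h₁ h₂ l l') (i : Fin 3) (x : E3) :
    pd i (fun x : E3 => h ‖x‖) x = h₁ ‖x‖ / ‖x‖ * x i := by
  by_cases hx : x = 0
  · subst hx
    have h0 : (0 : E3) ∉ tsupport fun x : E3 => h ‖x‖ := fun h0 => by
      have := (shell_tsupport_subset (fun x hx => H.supp ‖x‖ hx) h0).1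
      rw [norm_zero] at this
      exact absurd H.pos (not_lt.2 this)
    rw [pd, fderiv_of_notMem_tsupport ℝ h0]
    simp
  · exact pd_radial hx (H.hasDerivAt _) i

end IsShellProfile

theorem lapseWeight_contDiffOn {a M R : ℝ} (ha : 0 ≤ a) (haM : a ≤ M) (hR : 3 * M < R) :
    ContDiffOn ℝ ∞ (lapseWeight a M) {x | R < ‖x‖} := by
  have hn : ContDiffOn ℝ ∞ (fun x : E3 => ‖x‖) {x | R < ‖x‖} := fun x hx =>
    (contDiffAt_norm ℝ (norm_pos_iff.1 (by simp at hx; linarith))).contDiffWithinAt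
  have hc : ∀ i, ContDiffOn ℝ ∞ (fun x : E3 => x i) {x | R < ‖x‖} := fun i =>
    (EuclideanSpace.proj (𝕜 := ℝ) i).contDiff.contDiffOn
  have hΔ : ContDiffOn ℝ ∞ (fun x : E3 => Delta a M ‖x‖) {x | R < ‖x‖} :=
    (Delta_contDiff a M).comp_contDiffOn hn
  have h0 : ∀ x ∈ {x : E3 | R < ‖x‖}, ‖x‖ ^ 2 ≠ 0 := fun x hx => by
    have : 0 < ‖x‖ := by simp at hx; linarith
    positivity
  refine ContDiffOn.div ?_ ((hn.pow 2).mul hΔ) fun x hx =>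
    mul_ne_zero (h0 x hx) (Delta_pos ha haM hR (le_of_lt hx)).2.ne'
  exact (((hn.pow 2).add contDiffOn_const).pow 2).sub
    ((contDiffOn_const.mul hΔ).mul ((((hc 0).pow 2).add ((hc 1).pow 2)).div (hn.pow 2) h0))

/-- The lower bound comes from Δ ≤ r² + a² and sin² θ ≤ 1, the upper one from (2r²)² / (r² · r²/3) =
12. The lower bound keeps the data term large, the upper one controls the error from θ''. -/
theorem lapseWeight_bounds {a M R : ℝ} (ha : 0 ≤ a) (haM : a ≤ M) (hR : 3 * M < R) {x : E3}
    (hx : R < ‖x‖) : 1 ≤ lapseWeight a M x ∧ lapseWeight a M x ≤ 12 := by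
  have h0 : 0 < ‖x‖ := by linarith
  obtain ⟨hΔ, hΔ0⟩ := Delta_pos ha haM hR hx.le
  have hn := norm_sq_eq x
  have hs0 : 0 ≤ (x 0 ^ 2 + x 1 ^ 2) / ‖x‖ ^ 2 := by positivity
  have hs1 : (x 0 ^ 2 + x 1 ^ 2) / ‖x‖ ^ 2 ≤ 1 := by
    rw [div_le_one (by positivity)]; nlinarith [sq_nonneg (x 2)]
  unfold lapseWeight
  set s := (x 0 ^ 2 + x 1 ^ 2) / ‖x‖ ^ 2
  have hD : Delta a M ‖x‖ ≤ ‖x‖ ^ 2 + a ^ 2 := by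
    unfold Delta
    have := mul_nonneg (ha.trans haM) h0.le
    linarith
  have ha2 : a ^ 2 ≤ ‖x‖ ^ 2 := by gcongr; linarith
  set D := Delta a M ‖x‖
  set r := ‖x‖
  have hpos : 0 ≤ a ^ 2 * D * (1 - s) := by
    have := sub_nonneg.2 hs1
    positivity
  have hpos' : 0 ≤ a ^ 2 * D * s := by positivity
  constructor
  · rw [le_div_iff₀ (by positivity)]
    nlinarith [mul_nonneg (add_nonneg (sq_nonneg r) (sq_nonneg a)) (sub_nonneg.2 hD)]
  · rw [div_le_iff₀ (by positivity)]
    have h1 : (r ^ 2 + a ^ 2) ^ 2 ≤ (2 * r ^ 2) ^ 2 := by gcongr; linarith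
    have h2 : r ^ 2 * (r ^ 2 / 3) ≤ r ^ 2 * D := by gcongr
    nlinarith

/-! ### Weak integration by parts against radial functions. -/

namespace Slicing

variable {a M R : ℝ} {S : Slicing a M R} {p T : ℝ} {u₀ u₁ : E3 → ℝ} {u : ℝ → S.L2}
  {D : Fin 4 → ℝ → S.L2} {h h₁ h₂ : ℝ → ℝ} {l l' : ℝ}

theorem r₀_lt (ha : 0 ≤ a) (haM : a ≤ M) (hR : 3 * M < R) (S : Slicing a M R) : S.r₀ < R := by
  have h1 : Real.sqrt (M ^ 2 - a ^ 2) ≤ M :=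
    Real.sqrt_le_iff.2 ⟨ha.trans haM, by nlinarith⟩
  have h2 : rPlus a M ≤ 2 * M := by unfold rPlus; linarith
  rcases S.r₀_mem with h | h <;> linarith

namespace IsSolution

/-- The gradient of a radial function is parallel to x, so only the radial flux enters, and
`radial_flux` expresses it through x · ∇u. One weak integration by parts against a radial vector
field, whose divergence is `radialWave`, finishes the proof. -/
theorem integral_spatial_flux (hs : S.IsSolution p u₀ u₁ T u D) (ha : 0 ≤ a) (haM : a ≤ M)
    (hR : 3 * M < R) (H : IsShellProfile h h₁ h₂ l l') (hl : R < l) {t : ℝ} (ht : t ∈ Ico 0 T) :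
    ∫ x in outside S.r₀, ∑ i : Fin 3, S.flux (fun β => D β t) i.succ x
        * pd i (fun x => h ‖x‖) x
      = -∫ x in outside S.r₀, u t x * radialWave a M h₁ h₂ ‖x‖ := by
  have hr₀ := S.r₀_lt ha haM hR
  -- Δ/r² comes from the radial flux, h₁/r from ∇h = (h₁/r) x; the vector field is φ(r) x.
  set φ : ℝ → ℝ := fun r => Delta a M r / r ^ 3 * h₁ r with hφ
  have hφs : ContDiff ℝ ∞ φ := H.contDiff_mul₁ ((Delta_contDiff a M).contDiffOn.div
    (contDiffOn_id.pow 3) fun r hr => pow_ne_zero 3 (ne_of_gt hr))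
  have hφsupp : ∀ r, φ r ≠ 0 → l ≤ r ∧ r ≤ l' := fun r hr => H.supp₁ r (right_ne_zero_of_mul hr)
  have hζs : ∀ i : Fin 3, ContDiff ℝ ∞ fun x : E3 => φ ‖x‖ * x i := fun i =>
    (contDiff_radial H.pos hφs fun r hr => (hφsupp r hr).1).mul
      (EuclideanSpace.proj (𝕜 := ℝ) i).contDiff
  set ζ : Fin 3 → 𝓓(outside S.r₀, ℝ) := fun i =>
    shellTest (hζs i) (fun x hx => hφsupp ‖x‖ (left_ne_zero_of_mul hx)) (hr₀.trans hl) with hζ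
  have hζe : ∀ i x, ζ i x = φ ‖x‖ * x i := fun _ _ => rfl
  have e1 : ∀ x, ∑ i : Fin 3, S.flux (fun β => D β t) i.succ x * pd i (fun x => h ‖x‖) x
      = ∑ i : Fin 3, D i.succ t x * ζ i x := by
    intro x
    simp only [H.pd_norm, hζe]
    by_cases hx : h₁ ‖x‖ = 0
    · simp [hφ, hx]
    · have hxl := hl.trans_le (H.supp₁ _ hx).1
      have h0 := (H.pos.trans_le (H.supp₁ _ hx).1).ne'
      have := S.radial_flux ha haM hR hxl (fun β => D β t)
      calc _ = h₁ ‖x‖ / ‖x‖ * ∑ i : Fin 3, x i * S.flux (fun β => D β t) i.succ x := by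
            rw [Finset.mul_sum]; exact Finset.sum_congr rfl fun _ _ => by ring
        _ = _ := by
            rw [this, Finset.mul_sum, Finset.mul_sum]
            refine Finset.sum_congr rfl fun _ _ => ?_
            simp only [hφ]
            field_simp
  have e2 : ∀ x, ∑ i, pd i (ζ i) x = radialWave a M h₁ h₂ ‖x‖ := by
    intro x
    by_cases hx : x = 0
    · subst hx
      have h0 : ∀ i, (0 : E3) ∉ tsupport (ζ i) := fun i h0 => by
        have := (shell_tsupport_subset (f := ζ i)
          (fun x hx => hφsupp ‖x‖ (left_ne_zero_of_mul hx)) h0).1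
        rw [norm_zero] at this
        exact absurd H.pos (not_lt.2 this)
      simp only [pd, fderiv_of_notMem_tsupport ℝ (h0 _)]
      simp [radialWave]
    · have h0 := norm_ne_zero_iff.2 hx
      have hd : HasDerivAt φ (((2 * ‖x‖ - 2 * M) * ‖x‖ ^ 3 - Delta a M ‖x‖ * (3 * ‖x‖ ^ 2))
          / (‖x‖ ^ 3) ^ 2 * h₁ ‖x‖ + Delta a M ‖x‖ / ‖x‖ ^ 3 * h₂ ‖x‖) ‖x‖ := by
        have hΔ : HasDerivAt (Delta a M) (2 * ‖x‖ - 2 * M) ‖x‖ := by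
          have := (((hasDerivAt_id ‖x‖).pow 2).sub
            ((hasDerivAt_id ‖x‖).const_mul (2 * M))).add_const (a ^ 2)
          refine (this.congr_deriv (by simp)).congr_of_eventuallyEq (.of_forall fun r => ?_)
          simp [Delta]
        have h3 : HasDerivAt (fun r : ℝ => r ^ 3) (3 * ‖x‖ ^ 2) ‖x‖ := by
          simpa using hasDerivAt_pow 3 ‖x‖
        exact (hΔ.div h3 (pow_ne_zero 3 h0)).mul (H.hasDerivAt₁ _)
      have := fun i => pd_radial_mul_coord hx hd i i
      change ∑ i, pd i (fun x : E3 => φ ‖x‖ * x i) x = _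
      simp only [this, Fin.sum_univ_three, if_true]
      have hn := norm_sq_eq x
      rw [radialWave]
      simp only [hφ]
      generalize Delta a M ‖x‖ = d
      have key : ∀ A B : ℝ, A / ‖x‖ * x 0 * x 0 + B + (A / ‖x‖ * x 1 * x 1 + B)
          + (A / ‖x‖ * x 2 * x 2 + B) = A * ‖x‖ + 3 * B := by
        intro A B
        have : A * ‖x‖ = A / ‖x‖ * ‖x‖ ^ 2 := by field_simp
        rw [this, hn]; ring
      rw [key]
      field_simp
      ring
  have hi : ∀ i, Integrable (fun x => D i.succ t x * ζ i x)
      (volume.restrict (outside S.r₀ : Set E3)) := fun i => Lp.integrable_mul _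
    (continuous_hasCompactSupport_memLp (ζ i).continuous (ζ i).hasCompactSupport _)
  have hi' : ∀ i, Integrable (fun x => u t x * pd i (ζ i) x)
      (volume.restrict (outside S.r₀ : Set E3)) := fun i => Lp.integrable_mul _
    (continuous_hasCompactSupport_memLp
      (((ζ i).contDiff.continuous_fderiv (by simp)).clm_apply continuous_const)
      ((ζ i).hasCompactSupport.fderiv_apply ℝ _) _)
  simp only [e1]
  rw [integral_finsetSum _ fun i _ => hi i]
  simp only [← e2, Finset.mul_sum]
  rw [integral_finsetSum _ fun i _ => hi' i, ← Finset.sum_neg_distrib]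
  refine Finset.sum_congr rfl fun i _ => ?_
  rw [hs.weakDeriv t ht i (ζ i), neg_neg]

/-- The frame-dragging term is a rotation derivative of u with a radial coefficient. Moved onto the
test function it vanishes, since rotations annihilate radial functions; this is the symmetry `e2` of
the mixed derivatives. -/
theorem integral_time_flux (hs : S.IsSolution p u₀ u₁ T u D) (ha : 0 ≤ a) (haM : a ≤ M)
    (hR : 3 * M < R) (H : IsShellProfile h h₁ h₂ l l') (hl : R < l) {t : ℝ} (ht : t ∈ Ico 0 T) :
    ∫ x in outside S.r₀, S.flux (fun β => D β t) 0 x * h ‖x‖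
      = -∫ x in outside S.r₀, D 0 t x * (lapseWeight a M x * h ‖x‖) := by
  have hr₀ := S.r₀_lt ha haM hR
  have hR0 : 0 ≤ R := by linarith
  set φ : ℝ → ℝ := fun r => 2 * M * a / (r * Delta a M r) * h r with hφ
  have hφs : ContDiff ℝ ∞ φ := H.contDiff_mul_real hl (contDiffOn_const.div
    (contDiffOn_id.mul (Delta_contDiff a M).contDiffOn) fun r hr =>
      mul_ne_zero (ne_of_gt (hR0.trans_lt hr)) (Delta_pos ha haM hR (le_of_lt hr)).2.ne')
  have hφsupp : ∀ r, φ r ≠ 0 → l ≤ r ∧ r ≤ l' := fun r hr => H.supp r (right_ne_zero_of_mul hr)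
  have hζs : ∀ i : Fin 3, ContDiff ℝ ∞ fun x : E3 => φ ‖x‖ * x i := fun i =>
    (contDiff_radial H.pos hφs fun r hr => (hφsupp r hr).1).mul
      (EuclideanSpace.proj (𝕜 := ℝ) i).contDiff
  set ζ : Fin 3 → 𝓓(outside S.r₀, ℝ) := fun i =>
    shellTest (hζs i) (fun x hx => hφsupp ‖x‖ (left_ne_zero_of_mul hx)) (hr₀.trans hl) with hζ
  have hζe : ∀ i x, ζ i x = φ ‖x‖ * x i := fun _ _ => rfl
  have e1 : ∀ x, S.flux (fun β => D β t) 0 x * h ‖x‖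
      = -(D 0 t x * (lapseWeight a M x * h ‖x‖)) - (D 2 t x * ζ 0 x - D 1 t x * ζ 1 x) := by
    intro x
    rw [hζe, hζe]
    by_cases hx : h ‖x‖ = 0
    · simp [hφ, hx]
    · rw [S.time_flux ha haM hR (hl.trans_le (H.supp _ hx).1)]
      simp only [hφ]
      ring
  have e2 : ∀ x, pd 1 (ζ 0) x = pd 0 (ζ 1) x := by
    intro x
    by_cases hx : x = 0
    · subst hx
      have h0 : ∀ i, (0 : E3) ∉ tsupport (ζ i) := fun i h0 => by
        have := (shell_tsupport_subset (f := ζ i)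
          (fun x hx => hφsupp ‖x‖ (left_ne_zero_of_mul hx)) h0).1
        rw [norm_zero] at this
        exact absurd H.pos (not_lt.2 this)
      simp only [pd, fderiv_of_notMem_tsupport ℝ (h0 _)]
      rfl
    · have hd := (hφs.differentiable (by simp) ‖x‖).hasDerivAt
      refine (pd_radial_mul_coord hx hd 1 0).trans (Eq.trans ?_ (pd_radial_mul_coord hx hd 0 1).symm)
      simp
      ring
  have hi : ∀ i j, Integrable (fun x => D i t x * ζ j x)
      (volume.restrict (outside S.r₀ : Set E3)) := fun i j => Lp.integrable_mul _
    (continuous_hasCompactSupport_memLp (ζ j).continuous (ζ j).hasCompactSupport _)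
  have hi' : Integrable (fun x => D 0 t x * (lapseWeight a M x * h ‖x‖))
      (volume.restrict (outside S.r₀ : Set E3)) := Lp.integrable_mul _
    (continuous_hasCompactSupport_memLp
      (H.contDiff_mul hl (lapseWeight_contDiffOn ha haM hR)).continuous
      (H.hasCompactSupport_mul _) _)
  simp only [e1]
  have w1 := hs.weakDeriv t ht 1 (ζ 0)
  have w2 := hs.weakDeriv t ht 0 (ζ 1)
  simp only [e2] at w1
  rw [w2, neg_inj] at w1
  have w3 : ∫ x in outside S.r₀, D 1 t x * ζ 1 x = ∫ x in outside S.r₀, D 2 t x * ζ 0 x := w1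
  refine (integral_sub hi'.neg ((hi 2 0).sub (hi 1 1))).trans ?_
  exact (congrArg₂ (· - ·) (integral_neg _)
    ((integral_sub (hi 2 0) (hi 1 1)).trans (sub_eq_zero.2 w3.symm))).trans (sub_zero _)

end IsSolution
end Slicing

/-! ### The test function inequality. -/

/-- Young's inequality for the factors |v| (θh)^{1/p} and b: the linear error v e is absorbed by the
nonlinear term and leaves a constant independent of v. In the application c is the volume density.
-/
theorem young_lower_bound {p q : ℝ} (hpq : p.HolderConjugate q) {v b θ h c e : ℝ} (hθ : 0 ≤ θ)
    (hh : 0 ≤ h) (hc : 1 ≤ c) (hb : 0 ≤ b) (he : |e| ≤ b * (θ * h) ^ (1 / p)) :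
    -b ^ q ≤ θ * (c * |v| ^ p * h) + v * e := by
  have hp := hpq.lt
  have h1 := Real.young_inequality_of_nonneg (a := |v| * (θ * h) ^ (1 / p)) (by positivity) hb hpq
  have h2 : (|v| * (θ * h) ^ (1 / p)) ^ p = |v| ^ p * (θ * h) := by
    rw [Real.mul_rpow (abs_nonneg _) (by positivity), ← Real.rpow_mul (by positivity),
      one_div_mul_cancel hpq.ne_zero, Real.rpow_one]
  rw [h2] at h1
  have h3 : -(v * e) ≤ |v| * (θ * h) ^ (1 / p) * b := by
    calc -(v * e) ≤ |v * e| := neg_le_abs _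
      _ = |v| * |e| := abs_mul _ _
      _ ≤ |v| * (b * (θ * h) ^ (1 / p)) := by gcongr
      _ = _ := by ring
  have h4 : |v| ^ p * (θ * h) / p ≤ θ * (c * |v| ^ p * h) := by
    have : 0 ≤ |v| ^ p * (θ * h) := by positivity
    calc _ ≤ |v| ^ p * (θ * h) := div_le_self this hp.le
      _ ≤ c * (|v| ^ p * (θ * h)) := le_mul_of_one_le_left this hc
      _ = _ := by ring
  have h5 : b ^ q / q ≤ b ^ q := div_le_self (by positivity) hpq.symm.lt.le
  linarith

namespace IsShellProfile

variable {h h₁ h₂ : ℝ → ℝ} {l l' : ℝ}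

theorem eq_deriv₁ (H : IsShellProfile h h₁ h₂ l l') : h₂ = deriv h₁ :=
  funext fun r => (H.hasDerivAt₁ r).deriv.symm

theorem continuous₂ (H : IsShellProfile h h₁ h₂ l l') : Continuous h₂ := by
  rw [H.eq_deriv₁]; exact H.smooth₁.continuous_deriv (by simp)

theorem supp₂ (H : IsShellProfile h h₁ h₂ l l') (r : ℝ) (hr : h₂ r ≠ 0) : l ≤ r ∧ r ≤ l' := by
  rw [H.eq_deriv₁] at hr
  exact closure_minimal (fun r hr => H.supp₁ r hr) isClosed_Icc (support_deriv_subset hr)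

end IsShellProfile

theorem shell_isCompact (l l' : ℝ) : IsCompact {x : E3 | l ≤ ‖x‖ ∧ ‖x‖ ≤ l'} :=
  (isCompact_closedBall (0 : E3) l').of_isClosed_subset
    ((isClosed_le continuous_const continuous_norm).inter
      (isClosed_le continuous_norm continuous_const)) fun x hx => by simpa using hx.2

namespace Slicing

variable {a M R : ℝ} {S : Slicing a M R} {p T : ℝ} {u₀ u₁ : E3 → ℝ} {u : ℝ → S.L2}
  {D : Fin 4 → ℝ → S.L2} {h h₁ h₂ : ℝ → ℝ} {l l' : ℝ}

theorem one_le_vol (ha : 0 ≤ a) (haM : a ≤ M) (hR : 3 * M < R) {x : E3} (hx : R < ‖x‖) :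
    1 ≤ S.vol x := by
  have h0 : 0 < ‖x‖ := by linarith
  rw [S.vol_eq ha haM hR hx, one_le_div (by positivity), rhoSq]
  have : 0 ≤ a ^ 2 * (x 2 / ‖x‖) ^ 2 := by positivity
  linarith

namespace IsSolution

theorem integrable_nonlinearity (hs : S.IsSolution p u₀ u₁ T u D) (ha : 0 ≤ a) (haM : a ≤ M)
    (hR : 3 * M < R) (H : IsShellProfile h h₁ h₂ l l') (hl : R < l) {t : ℝ} (ht : t ∈ Ico 0 T) :
    Integrable (fun x => S.vol x * |u t x| ^ p * h ‖x‖)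
      (volume.restrict (outside S.r₀ : Set E3)) := by
  have hr₀ := S.r₀_lt ha haM hR
  have hR0 : 0 ≤ R := by linarith
  set K : Set E3 := {x | l ≤ ‖x‖ ∧ ‖x‖ ≤ l'} with hK
  have hKc : IsCompact K := shell_isCompact l l'
  have h1 : IntegrableOn (fun x => |u t x| ^ p) K :=
    (hs.locallyIntegrable t ht).integrableOn_compact_subset
      (fun x hx => (hr₀.trans hl).trans_le hx.1) hKc
  have hn : ContinuousOn (fun x : E3 => rhoSq a x / ‖x‖ ^ 2 * h ‖x‖) K := by
    have h0 : ∀ x ∈ K, ‖x‖ ≠ 0 := fun x hx => (H.pos.trans_le hx.1).ne'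
    unfold rhoSq
    have hc : ContinuousOn (fun x : E3 => x 2) K :=
      (EuclideanSpace.proj (𝕜 := ℝ) (2 : Fin 3)).continuous.continuousOn
    have hh := H.contDiff_norm.continuous.continuousOn (s := K)
    have hn : ContinuousOn (fun x : E3 => ‖x‖) K := continuous_norm.continuousOn
    exact (((hn.pow 2).add (continuousOn_const.mul ((hc.div hn h0).pow 2))).div (hn.pow 2)
      fun x hx => pow_ne_zero 2 (h0 x hx)).mul hh
  have h2 := h1.mul_continuousOn hn hKc
  have h3 : IntegrableOn (fun x => S.vol x * |u t x| ^ p * h ‖x‖) K := by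
    refine h2.congr_fun (fun x hx => ?_) hKc.measurableSet
    simp only
    rw [S.vol_eq ha haM hR (hl.trans_le hx.1)]
    ring
  exact ((integrableOn_iff_integrable_of_support_subset
    fun x hx => H.supp ‖x‖ (right_ne_zero_of_mul hx)).1 h3).integrableOn

/-- The pointwise Young bound, integrated over the shell that carries all integrands; the volume of
the shell is estimated by that of the ball. -/
theorem lower_bound (hs : S.IsSolution p u₀ u₁ T u D) (ha : 0 ≤ a) (haM : a ≤ M)
    (hR : 3 * M < R) (H : IsShellProfile h h₁ h₂ l l') (hl : R < l) {t : ℝ} (ht : t ∈ Ico 0 T)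
    {q : ℝ} (hpq : p.HolderConjugate q) (hh : ∀ r, 0 ≤ h r)
    {θ θ₂ b : ℝ} (hθ : 0 ≤ θ) (hb : 0 ≤ b)
    (hbd : ∀ x : E3, l ≤ ‖x‖ → ‖x‖ ≤ l' →
      |θ * radialWave a M h₁ h₂ ‖x‖ - θ₂ * (lapseWeight a M x * h ‖x‖)|
        ≤ b * (θ * h ‖x‖) ^ (1 / p)) :
    -(b ^ q * volume.real (Metric.closedBall (0 : E3) l')) ≤
      θ * ((∫ x in outside S.r₀, u t x * radialWave a M h₁ h₂ ‖x‖)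
          + ∫ x in outside S.r₀, S.vol x * |u t x| ^ p * h ‖x‖)
        - θ₂ * ∫ x in outside S.r₀, u t x * (lapseWeight a M x * h ‖x‖) := by
  have hr₀ := S.r₀_lt ha haM hR
  set K : Set E3 := {x | l ≤ ‖x‖ ∧ ‖x‖ ≤ l'} with hK
  have hKc : IsCompact K := shell_isCompact l l'
  have hsL : ∀ x : E3, radialWave a M h₁ h₂ ‖x‖ ≠ 0 → x ∈ K := by
    intro x hx
    by_contra hxK
    have e1 : h₁ ‖x‖ = 0 := by by_contra h0; exact hxK (H.supp₁ _ h0)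
    have e2 : h₂ ‖x‖ = 0 := by by_contra h0; exact hxK (H.supp₂ _ h0)
    exact hx (by simp [radialWave, e1, e2])
  have hcL : Continuous fun x : E3 => radialWave a M h₁ h₂ ‖x‖ := by
    have hr : ∀ r, r ≤ l / 2 → radialWave a M h₁ h₂ r = 0 := by
      intro r hr
      have e1 : h₁ r = 0 := by by_contra h0; linarith [(H.supp₁ _ h0).1, H.pos]
      have e2 : h₂ r = 0 := by by_contra h0; linarith [(H.supp₂ _ h0).1, H.pos]
      simp [radialWave, e1, e2]
    have hcr : Continuous (radialWave a M h₁ h₂) := by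
      rw [continuous_iff_continuousAt]
      intro r
      by_cases hr0 : r < l / 2
      · refine continuousAt_const (y := 0) |>.congr ?_
        filter_upwards [gt_mem_nhds hr0] with y hy
        exact (hr y hy.le).symm
      · have h0 : r ^ 2 ≠ 0 := by have := H.pos; have : 0 < r := by linarith
                                  positivity
        have c₁ := H.smooth₁.continuous.continuousAt (x := r)
        have c₂ := H.continuous₂.continuousAt (x := r)
        have cΔ := (Delta_contDiff a M).continuous.continuousAt (x := r)
        unfold radialWave
        have hr2 : ContinuousAt (fun r : ℝ => r ^ 2) r := by fun_prop
        have hr1 : ContinuousAt (fun r : ℝ => 2 * r - 2 * M) r := by fun_prop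
        exact ((hr1.div hr2 h0).mul c₁).add ((cΔ.div hr2 h0).mul c₂)
    exact hcr.comp continuous_norm
  have hiL : Integrable (fun x => u t x * radialWave a M h₁ h₂ ‖x‖)
      (volume.restrict (outside S.r₀ : Set E3)) := Lp.integrable_mul _
    (continuous_hasCompactSupport_memLp hcL
      (HasCompactSupport.of_support_subset_isCompact hKc hsL) _)
  have hiW : Integrable (fun x => u t x * (lapseWeight a M x * h ‖x‖))
      (volume.restrict (outside S.r₀ : Set E3)) := Lp.integrable_mul _
    (continuous_hasCompactSupport_memLp
      (H.contDiff_mul hl (lapseWeight_contDiffOn ha haM hR)).continuous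
      (H.hasCompactSupport_mul _) _)
  have hiV := hs.integrable_nonlinearity ha haM hR H hl ht
  have hsum := integral_sub ((hiL.add hiV).const_mul θ) (hiW.const_mul θ₂)
  rw [integral_const_mul, integral_const_mul] at hsum
  have hadd := integral_add hiL hiV
  refine le_of_le_of_eq ?_ (hsum.trans (congrArg (fun z => θ * z - _) hadd))
  have hconst : Integrable (K.indicator fun _ => -b ^ q)
      (volume.restrict (outside S.r₀ : Set E3)) := by
    rw [integrable_indicator_iff hKc.measurableSet]
    exact (integrableOn_const (hs := hKc.measure_lt_top.ne)).restrict
  calc _ ≤ ∫ x in outside S.r₀, K.indicator (fun _ => -b ^ q) x := by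
        rw [integral_indicator hKc.measurableSet, Measure.restrict_restrict hKc.measurableSet,
          setIntegral_const, smul_eq_mul, mul_neg, mul_comm, neg_le_neg_iff]
        have : K ∩ outside S.r₀ ⊆ Metric.closedBall (0 : E3) l' := fun x hx => by
          simpa using hx.1.2
        gcongr
        exact (isCompact_closedBall _ _).measure_lt_top.ne
    _ ≤ _ := by
        refine integral_mono hconst (((hiL.add hiV).const_mul _).sub (hiW.const_mul _)) fun x => ?_
        by_cases hx : x ∈ K
        · rw [indicator_of_mem hx]
          have := young_lower_bound hpq (v := u t x) hθ (hh ‖x‖)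
            (S.one_le_vol ha haM hR (hl.trans_le hx.1)) hb (hbd x hx.1 hx.2)
          simp only [Pi.add_apply]
          linarith
        · rw [indicator_of_notMem hx]
          have e1 : h ‖x‖ = 0 := by by_contra h0; exact hx (H.supp _ h0)
          have e2 : radialWave a M h₁ h₂ ‖x‖ = 0 := by by_contra h0; exact hx (hsL x h0)
          simp [e1, e2]

/-- The test function argument: an upper bound for the data if the solution exists up to time
`τ`. -/
theorem data_bound (hs : S.IsSolution p u₀ u₁ T u D) (ha : 0 ≤ a) (haM : a ≤ M)
    (hR : 3 * M < R) (H : IsShellProfile h h₁ h₂ l l') (hl : R < l) {τ : ℝ} (hτ : 0 ≤ τ)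
    (hτT : τ < T) {q : ℝ} (hpq : p.HolderConjugate q) (hh : ∀ r, 0 ≤ h r)
    {θ θ₁ θ₂ : ℝ → ℝ} {b : ℝ}
    (hθ₁ : ∀ t, HasDerivAt θ (θ₁ t) t) (hθ₂ : ∀ t, HasDerivAt θ₁ (θ₂ t) t)
    (hθ : ∀ t ∈ Icc 0 τ, 0 ≤ θ t) (hb : 0 ≤ b) (hθτ : θ τ = 0) (hθ₁τ : θ₁ τ = 0)
    (hbd : ∀ t ∈ Icc 0 τ, ∀ x : E3, l ≤ ‖x‖ → ‖x‖ ≤ l' →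
      |θ t * radialWave a M h₁ h₂ ‖x‖ - θ₂ t * (lapseWeight a M x * h ‖x‖)|
        ≤ b * (θ t * h ‖x‖) ^ (1 / p))
    (hu₀ : ∀ x, u₀ x = 0) :
    θ 0 * ∫ x in outside S.r₀, u₁ x * (lapseWeight a M x * h ‖x‖)
      ≤ b ^ q * volume.real (Metric.closedBall (0 : E3) l') * τ := by
  have hr₀ := S.r₀_lt ha haM hR
  have hW : MemLp (fun x : E3 => lapseWeight a M x * h ‖x‖) 2
      (volume.restrict (outside S.r₀ : Set E3)) := continuous_hasCompactSupport_memLp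
      (H.contDiff_mul hl (lapseWeight_contDiffOn ha haM hR)).continuous
      (H.hasCompactSupport_mul _) _
  set η : 𝓓(outside S.r₀, ℝ) :=
    shellTest H.contDiff_norm (fun x hx => H.supp ‖x‖ hx) (hr₀.trans hl) with hη
  have hηe : (η : E3 → ℝ) = fun x => h ‖x‖ := rfl
  set G : ℝ → ℝ := fun s => ∫ x in outside S.r₀, u s x * (lapseWeight a M x * h ‖x‖) with hG
  set G₁ : ℝ → ℝ := fun s => ∫ x in outside S.r₀, D 0 s x * (lapseWeight a M x * h ‖x‖) with hG₁
  set G₂ : ℝ → ℝ := fun t => (∫ x in outside S.r₀, u t x * radialWave a M h₁ h₂ ‖x‖)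
          + ∫ x in outside S.r₀, S.vol x * |u t x| ^ p * h ‖x‖ with hG₂
  have dG : ∀ t ∈ Ico 0 T, HasDerivWithinAt G (G₁ t) (Ico 0 T) t := fun t ht =>
    Lp.hasDerivWithinAt_integral_mul (hs.hasDeriv t ht) hW
  have dG₁ : ∀ t ∈ Ico 0 T, HasDerivWithinAt G₁ (G₂ t) (Ico 0 T) t := by
    intro t ht
    have h1 := (hs.equation η t ht).neg
    rw [hηe, hs.integral_spatial_flux ha haM hR H hl ht] at h1
    refine (h1.congr_of_mem (fun s hs' => ?_) ht).congr_deriv ?_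
    · rw [Pi.neg_apply, hs.integral_time_flux ha haM hR H hl hs', neg_neg]
    · simp only [hG₂]; ring
  set β := b ^ q * volume.real (Metric.closedBall (0 : E3) l') with hβ
  -- The Wronskian of θ and G has derivative θ G₂ - θ₂ G ≥ -β, so adding βt makes it monotone.
  -- Comparing the endpoints replaces two integrations by parts in time and needs no integrability
  -- of G₂.
  set Ψ : ℝ → ℝ := fun t => θ t * G₁ t - θ₁ t * G t + β * t with hΨ
  have dΨ : ∀ t ∈ Ico 0 T, HasDerivWithinAt Ψ (θ t * G₂ t - θ₂ t * G t + β) (Ico 0 T) t := by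
    intro t ht
    have := (((hθ₁ t).hasDerivWithinAt.mul (dG₁ t ht)).sub
      ((hθ₂ t).hasDerivWithinAt.mul (dG t ht))).add ((hasDerivWithinAt_id t _).const_mul β)
    exact this.congr_deriv (by ring)
  have hsub : Icc 0 τ ⊆ Ico 0 T := fun t ht => ⟨ht.1, ht.2.trans_lt hτT⟩
  have hmono : MonotoneOn Ψ (Icc 0 τ) := by
    refine monotoneOn_of_hasDerivWithinAt_nonneg (convex_Icc 0 τ)
      (fun t ht => ((dΨ t (hsub ht)).continuousWithinAt).mono hsub)
      (fun t ht => (dΨ t (hsub (interior_subset ht))).mono (interior_subset.trans hsub)) ?_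
    intro t ht
    have ht' := interior_subset ht
    have := hs.lower_bound ha haM hR H hl (hsub ht') hpq hh (hθ t ht') hb (hbd t ht')
    linarith
  have hle := hmono (left_mem_Icc.2 hτ) (right_mem_Icc.2 hτ) hτ
  have hT0 : (0 : ℝ) ∈ Ico 0 T := ⟨le_rfl, hτ.trans_lt hτT⟩
  have hG0 : G 0 = 0 := by
    refine integral_eq_zero_of_ae ?_
    filter_upwards [hs.initial] with x hx
    simp [hx, hu₀]
  have hG₁0 : G₁ 0 = ∫ x in outside S.r₀, u₁ x * (lapseWeight a M x * h ‖x‖) := by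
    refine integral_congr_ae ?_
    filter_upwards [hs.initial_deriv] with x hx
    by_cases h0 : h ‖x‖ = 0
    · simp [h0]
    · rw [← hx, S.tvec_far x (hl.trans_le (H.supp _ h0).1), Fin.sum_univ_four]
      simp
  simp only [hΨ, hθτ, hθ₁τ, hG0, hG₁0] at hle
  linarith

end IsSolution
end Slicing

/-! ### Rescaling and blow-up before time τ. -/

theorem IsShellProfile.scale {h h₁ h₂ : ℝ → ℝ} {l l' : ℝ} (H : IsShellProfile h h₁ h₂ l l')
    {τ : ℝ} (hτ : 0 < τ) :
    IsShellProfile (fun r => h (r / τ)) (fun r => h₁ (r / τ) / τ) (fun r => h₂ (r / τ) / τ / τ)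
      (l * τ) (l' * τ) where
  pos := mul_pos H.pos hτ
  smooth := H.smooth.comp (contDiff_id.div_const τ)
  smooth₁ := (H.smooth₁.comp (contDiff_id.div_const τ)).div_const τ
  hasDerivAt r := by
    have := (H.hasDerivAt (r / τ)).comp r ((hasDerivAt_id r).div_const τ)
    exact this.congr_deriv (by ring)
  hasDerivAt₁ r := by
    have := ((H.hasDerivAt₁ (r / τ)).comp r ((hasDerivAt_id r).div_const τ)).div_const τ
    exact this.congr_deriv (by ring)
  supp r hr := by
    have := H.supp _ hr
    rwa [le_div_iff₀ hτ, div_le_iff₀ hτ] at this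
  supp₁ r hr := by
    have := H.supp₁ (r / τ) fun h0 => hr (by simp [h0])
    rwa [le_div_iff₀ hτ, div_le_iff₀ hτ] at this

/-- The operator is of second order with coefficients (2r - 2M)/r² ≤ 2/τ and Δ/r² ≤ 2 on r ≥ τ, so
it gains τ⁻² as the flat Laplacian does. -/
theorem abs_radialWave_scale_le {a M R : ℝ} (ha : 0 ≤ a) (haM : a ≤ M) (hR : 3 * M < R)
    {h₁ h₂ : ℝ → ℝ} {τ r c : ℝ} (hτ : R < τ) (hr : τ ≤ r) (hc₁ : |h₁ (r / τ)| ≤ c)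
    (hc₂ : |h₂ (r / τ)| ≤ c) :
    |radialWave a M (fun r => h₁ (r / τ) / τ) (fun r => h₂ (r / τ) / τ / τ) r|
      ≤ 4 * c * (τ⁻¹) ^ 2 := by
  have hτ0 : 0 < τ := by linarith
  have hr0 : 0 < r := by linarith
  have hM : 0 ≤ M := ha.trans haM
  have hΔ := (Delta_pos ha haM hR (hτ.le.trans hr)).2
  have hc : 0 ≤ c := (abs_nonneg _).trans hc₁
  have e1 : |(2 * r - 2 * M) / r ^ 2| ≤ 2 * τ⁻¹ := by
    rw [abs_of_nonneg (div_nonneg (by linarith) (by positivity)), div_le_iff₀ (by positivity)]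
    have : r ≤ τ⁻¹ * r ^ 2 := by
      rw [inv_mul_eq_div, le_div_iff₀ hτ0]; nlinarith
    linarith
  have e2 : |Delta a M r / r ^ 2| ≤ 2 := by
    rw [abs_of_nonneg (by positivity), div_le_iff₀ (by positivity)]
    unfold Delta
    nlinarith [mul_nonneg hM hr0.le]
  calc _ ≤ |(2 * r - 2 * M) / r ^ 2 * (h₁ (r / τ) / τ)|
        + |Delta a M r / r ^ 2 * (h₂ (r / τ) / τ / τ)| := abs_add_le _ _
    _ = |(2 * r - 2 * M) / r ^ 2| * (|h₁ (r / τ)| * τ⁻¹)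
        + |Delta a M r / r ^ 2| * (|h₂ (r / τ)| * τ⁻¹ * τ⁻¹) := by
      simp only [abs_mul, abs_of_pos hτ0, div_eq_mul_inv, abs_inv]
    _ ≤ 2 * τ⁻¹ * (c * τ⁻¹) + 2 * (c * τ⁻¹ * τ⁻¹) := by gcongr
    _ = _ := by ring

/-- On [0, 1] a smaller exponent gives a larger power. This is where n must be large: it turns the
factor left after two derivatives into the (θh)^{1/p} required by Young's inequality. -/
theorem pow_le_rpow_pow {n : ℕ} {p y : ℝ} (hp : 0 < p) (hn : ((n : ℝ) + 2) / p ≤ n) (hy0 : 0 ≤ y)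
    (hy1 : y ≤ 1) : y ^ n ≤ (y ^ (n + 2)) ^ (1 / p) := by
  rw [← Real.rpow_natCast, ← Real.rpow_natCast, ← Real.rpow_mul hy0]
  apply Real.rpow_le_rpow_of_exponent_ge' hy0 hy1 (by positivity)
  push_cast
  rw [mul_one_div]
  exact hn

theorem integral_scale (f : ℝ → ℝ) {τ : ℝ} (hτ : 0 < τ) :
    ∫ x : E3, f (‖x‖ / τ) = τ ^ 3 * ∫ x : E3, f ‖x‖ := by
  have := Measure.integral_comp_inv_smul (μ := (volume : Measure E3)) (fun x => f ‖x‖) τ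
  simp only [finrank_euclideanSpace_fin, smul_eq_mul, norm_smul, norm_inv, Real.norm_eq_abs,
    abs_of_pos hτ, abs_of_pos (pow_pos hτ 3)] at this
  rw [← this]
  simp only [div_eq_inv_mul]

namespace Slicing

variable {a M R : ℝ} {p : ℝ}

/-- Large data at the length scale `τ` lead to blow-up before the time `τ`. -/
theorem exists_lifespan_le (ha : 0 ≤ a) (haM : a ≤ M) (hR : 3 * M < R) (hp : 1 < p)
    (S : Slicing a M R) {χ h₁ h₂ : ℝ → ℝ} {n : ℕ} {C : ℝ} (hn : ((n : ℝ) + 2) / p ≤ n)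
    (hχ0 : ∀ r, 0 ≤ χ r) (hχ1 : ∀ r, χ r ≤ 1) (hC : 0 ≤ C)
    (H : IsShellProfile (fun r => χ r ^ (n + 2)) h₁ h₂ 1 2) (hb₁ : ∀ r, |h₁ r| ≤ C * χ r ^ n)
    (hb₂ : ∀ r, |h₂ r| ≤ C * χ r ^ n) (hne : χ (3 / 2) ≠ 0) :
    ∃ A > 0, ∀ τ, R < τ → ∀ u₀ u₁ : E3 → ℝ, (∀ x, u₀ x = 0) →
      (∀ x, u₁ x = A * τ ^ (-2 / (p - 1) - 1) * χ (‖x‖ / τ) ^ (n + 2)) →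
      S.lifespan p u₀ u₁ ≤ ENNReal.ofReal τ := by
  have hpq := Real.HolderConjugate.conjExponent hp
  set q := p.conjExponent with hq
  have hR0 : 0 ≤ R := by linarith
  have hp0 : 0 < p := by linarith
  -- The first summand bounds the spatial operator, the second bounds θ'' W.
  set b₀ : ℝ := 4 * C + 12 * ((n + 2) * (n + 1)) with hb₀
  have hb₀0 : 0 ≤ b₀ := by positivity
  set V := volume.real (Metric.closedBall (0 : E3) 1) with hV
  set c₀ := ∫ x : E3, (χ ‖x‖ ^ (n + 2)) ^ 2 with hc₀
  have hcont : Continuous fun x : E3 => (χ ‖x‖ ^ (n + 2)) ^ 2 := (H.contDiff_norm.continuous).pow 2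
  have hcomp : HasCompactSupport fun x : E3 => (χ ‖x‖ ^ (n + 2)) ^ 2 :=
    HasCompactSupport.of_support_subset_isCompact (shell_isCompact 1 2) fun x hx =>
      H.supp ‖x‖ (pow_ne_zero_iff (two_ne_zero) |>.1 hx)
  have hc₀pos : 0 < c₀ := by
    refine hcont.integral_pos_of_hasCompactSupport_nonneg_nonzero hcomp
      (fun x => by positivity) (x := EuclideanSpace.single 0 (3 / 2)) ?_
    have : ‖(EuclideanSpace.single 0 (3 / 2) : E3)‖ = 3 / 2 := by
      rw [PiLp.norm_single, Real.norm_of_nonneg (by norm_num)]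
    rw [this]
    positivity
  -- A is chosen so that A c₀ exceeds the constant in the data bound by 1; 8 = 2³ comes from the
  -- ball of radius 2τ.
  refine ⟨(b₀ ^ q * (8 * V) + 1) / c₀, by positivity, fun τ hτ u₀ u₁ hu₀ hu₁ => ?_⟩
  have hτ0 : 0 < τ := by linarith
  refine iSup₂_le fun T hT => ENNReal.ofReal_le_ofReal ?_
  obtain ⟨hT0, u, D, hs⟩ := hT
  by_contra! hτT
  have Hτ := H.scale hτ0
  rw [one_mul] at Hτ
  have hχ01 : ∀ r, 0 ≤ χ r ^ (n + 2) ∧ χ r ^ (n + 2) ≤ 1 := fun r =>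
    ⟨pow_nonneg (hχ0 r) _, pow_le_one₀ (hχ0 r) (hχ1 r)⟩
  have key := hs.data_bound ha haM hR Hτ hτ hτ0.le hτT hpq (fun r => (hχ01 _).1)
    (θ := fun t => (1 - t / τ) ^ (n + 2)) (θ₁ := fun t => (n + 2) * (1 - t / τ) ^ (n + 1) * (-τ⁻¹))
    (θ₂ := fun t => (n + 2) * ((n + 1) * (1 - t / τ) ^ n * (-τ⁻¹)) * (-τ⁻¹))
    (b := b₀ * (τ⁻¹) ^ 2) ?_ ?_ ?_ (by positivity) ?_ ?_ ?_ hu₀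
  rotate_left
  · intro t
    have h0 : HasDerivAt (fun t : ℝ => 1 - t / τ) (-τ⁻¹) t :=
      (((hasDerivAt_id t).div_const τ).const_sub 1).congr_deriv (by ring)
    refine (h0.fun_pow (n + 2)).congr_deriv ?_
    rw [Nat.add_succ_sub_one]; push_cast; rfl
  · intro t
    have h0 : HasDerivAt (fun t : ℝ => 1 - t / τ) (-τ⁻¹) t :=
      (((hasDerivAt_id t).div_const τ).const_sub 1).congr_deriv (by ring)
    refine (((h0.fun_pow (n + 1)).const_mul ((n : ℝ) + 2)).mul_const (-τ⁻¹)).congr_deriv ?_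
    rw [Nat.add_sub_cancel]; push_cast; rfl
  · intro t ht
    exact pow_nonneg (sub_nonneg.2 ((div_le_one hτ0).2 ht.2)) _
  · simp [div_self hτ0.ne']
  · simp [div_self hτ0.ne']
  · intro t ht x hx _
    have hs0 : 0 ≤ 1 - t / τ := sub_nonneg.2 ((div_le_one hτ0).2 ht.2)
    have hs1 : 1 - t / τ ≤ 1 := sub_le_self _ (div_nonneg ht.1 hτ0.le)
    have hL := abs_radialWave_scale_le ha haM hR hτ hx (hb₁ (‖x‖ / τ)) (hb₂ (‖x‖ / τ))
    have hW := lapseWeight_bounds ha haM hR (hτ.trans_le hx)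
    set s := 1 - t / τ
    set y := χ (‖x‖ / τ)
    have hy0 : 0 ≤ y := hχ0 _
    have hy1 : y ≤ 1 := hχ1 _
    set L := radialWave a M (fun r => h₁ (r / τ) / τ) (fun r => h₂ (r / τ) / τ / τ) ‖x‖
    set W := lapseWeight a M x
    have hpw := pow_le_rpow_pow hp0 hn (mul_nonneg hs0 hy0) (mul_le_one₀ hs1 hy0 hy1)
    have m1 : s ^ (n + 2) ≤ s ^ n := pow_le_pow_of_le_one hs0 hs1 (by omega)
    have m2 : y ^ (n + 2) ≤ y ^ n := pow_le_pow_of_le_one hy0 hy1 (by omega)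
    rw [← mul_pow]
    calc _ ≤ |s ^ (n + 2) * L| + |(n + 2) * ((n + 1) * s ^ n * (-τ⁻¹)) * (-τ⁻¹)
            * (W * y ^ (n + 2))| := abs_sub _ _
      _ = s ^ (n + 2) * |L| + (n + 2) * (n + 1) * s ^ n * τ⁻¹ ^ 2 * (W * y ^ (n + 2)) := by
          rw [abs_mul, abs_of_nonneg (pow_nonneg hs0 _)]
          congr 1
          rw [abs_of_nonneg]
          · ring
          · have : 0 ≤ W := by linarith
            have : 0 ≤ (n + 2) * ((n + 1) * s ^ n) * (τ⁻¹ * τ⁻¹) * (W * y ^ (n + 2)) := by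
              positivity
            linarith
      _ ≤ s ^ n * (4 * (C * y ^ n) * τ⁻¹ ^ 2)
            + (n + 2) * (n + 1) * s ^ n * τ⁻¹ ^ 2 * (12 * y ^ n) := by
          have : 0 ≤ W := by linarith
          gcongr
          exact hW.2
      _ = b₀ * τ⁻¹ ^ 2 * (s * y) ^ n := by rw [hb₀, mul_pow]; ring
      _ ≤ _ := by gcongr
  simp only [zero_div, sub_zero, one_pow, one_mul] at key
  set A := (b₀ ^ q * (8 * V) + 1) / c₀ with hA
  have hA0 : 0 < A := by positivity
  set α := -2 / (p - 1) - 1 with hα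
  have hdata : A * τ ^ α * (τ ^ 3 * c₀)
      ≤ ∫ x in outside S.r₀, u₁ x * (lapseWeight a M x * χ (‖x‖ / τ) ^ (n + 2)) := by
    have hW := Hτ.contDiff_mul hτ (lapseWeight_contDiffOn ha haM hR)
    have hint : Integrable fun x : E3 => u₁ x * (lapseWeight a M x * χ (‖x‖ / τ) ^ (n + 2)) := by
      refine Continuous.integrable_of_hasCompactSupport (Continuous.mul ?_ hW.continuous)
        ((Hτ.hasCompactSupport_mul _).mul_left)
      rw [funext hu₁]
      exact continuous_const.mul Hτ.contDiff_norm.continuous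
    have hint' : Integrable fun x : E3 => A * τ ^ α * (χ (‖x‖ / τ) ^ (n + 2)) ^ 2 := by
      refine Continuous.integrable_of_hasCompactSupport
        (continuous_const.mul (Hτ.contDiff_norm.continuous.pow 2)) ?_
      exact HasCompactSupport.of_support_subset_isCompact (shell_isCompact τ (2 * τ)) fun x hx =>
        Hτ.supp ‖x‖ (pow_ne_zero_iff (two_ne_zero) |>.1 (right_ne_zero_of_mul hx))
    have hset : ∫ x in outside S.r₀, u₁ x * (lapseWeight a M x * χ (‖x‖ / τ) ^ (n + 2))
        = ∫ x, u₁ x * (lapseWeight a M x * χ (‖x‖ / τ) ^ (n + 2)) := by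
      refine setIntegral_eq_integral_of_forall_compl_eq_zero fun x hx => ?_
      have : χ (‖x‖ / τ) ^ (n + 2) = 0 := by
        by_contra h0
        exact hx (((S.r₀_lt ha haM hR).trans hτ).trans_le (Hτ.supp _ h0).1)
      rw [this]; simp
    rw [hset, hc₀, ← integral_scale (fun r => (χ r ^ (n + 2)) ^ 2) hτ0, ← integral_const_mul]
    refine integral_mono hint' hint fun x => ?_
    simp only [hu₁]
    by_cases h0 : χ (‖x‖ / τ) ^ (n + 2) = 0
    · simp [h0]
    · have := (lapseWeight_bounds ha haM hR (hτ.trans_le (Hτ.supp _ h0).1)).1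
      have h1 : 0 ≤ A * τ ^ α * (χ (‖x‖ / τ) ^ (n + 2)) ^ 2 := by positivity
      nlinarith
  have hvol : volume.real (Metric.closedBall (0 : E3) (2 * τ)) = 8 * τ ^ 3 * V := by
    rw [Measure.addHaar_real_closedBall' _ _ (by positivity)]
    simp
    ring
  -- The identity 1 - 2q = -2/(p-1) - 1 = α: both sides of the data bound scale alike, so the size
  -- of A decides.
  have hpow : (b₀ * τ⁻¹ ^ 2) ^ q * τ = b₀ ^ q * τ ^ α := by
    rw [Real.mul_rpow hb₀0 (by positivity), mul_assoc]
    congr 1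
    rw [← Real.rpow_natCast, ← Real.rpow_mul (by positivity), Real.inv_rpow hτ0.le,
      ← Real.rpow_neg hτ0.le, ← Real.rpow_add_one hτ0.ne']
    congr 1
    have : p - 1 ≠ 0 := by linarith
    rw [hα, hq, Real.conjExponent]
    push_cast
    field_simp
    ring
  have hfin : A * τ ^ α * (τ ^ 3 * c₀) ≤ b₀ ^ q * τ ^ α * (8 * τ ^ 3 * V) := by
    refine hdata.trans (key.trans (le_of_eq ?_))
    rw [hvol, ← hpow]; ring
  have hAc : A * c₀ = b₀ ^ q * (8 * V) + 1 := div_mul_cancel₀ _ hc₀pos.ne'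
  have hlt : 0 < τ ^ α * τ ^ 3 := by positivity
  have : (b₀ ^ q * (8 * V) + 1) * (τ ^ α * τ ^ 3) ≤ b₀ ^ q * (8 * V) * (τ ^ α * τ ^ 3) := by
    rw [← hAc]; linarith
  linarith

end Slicing

/-! ### Scaling and finiteness of the data norms. -/

theorem eLpNorm_comp_smul {F : Type*} [NormedAddCommGroup F] (f : E3 → F) {c : ℝ} (hc : 0 < c) :
    eLpNorm (fun x => f (c • x)) 2 volume
      = ENNReal.ofReal (c ^ (-(3 / 2) : ℝ)) * eLpNorm f 2 volume := by
  have he : MeasurableEmbedding fun x : E3 => c • x :=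
    (Homeomorph.smulOfNeZero c hc.ne').measurableEmbedding
  have h1 := he.eLpNorm_map_measure (g := f) (p := 2) (μ := (volume : Measure E3))
  rw [Measure.map_addHaar_smul _ hc.ne', eLpNorm_smul_measure_of_ne_top (by simp)] at h1
  refine h1.symm.trans ?_
  rw [smul_eq_mul, finrank_euclideanSpace_fin, abs_of_pos (by positivity),
    ENNReal.ofReal_rpow_of_pos (by positivity)]
  congr 2
  rw [← Real.rpow_natCast, ← Real.rpow_neg hc.le, ← Real.rpow_mul hc.le]
  norm_num

theorem fourier_scale (f : E3 → ℂ) {τ : ℝ} (hτ : 0 < τ) (ξ : E3) :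
    𝓕 (fun x => f (τ⁻¹ • x)) ξ = (τ : ℂ) ^ 3 * 𝓕 f (τ • ξ) := by
  rw [Real.fourier_eq, Real.fourier_eq]
  have := Measure.integral_comp_inv_smul (μ := (volume : Measure E3))
    (fun v => Real.fourierChar (-(inner ℝ v (τ • ξ))) • f v) τ
  rw [finrank_euclideanSpace_fin, abs_of_pos (by positivity)] at this
  have h2 : ∀ v : E3, inner ℝ (τ⁻¹ • v) (τ • ξ) = inner ℝ v ξ := fun v => by
    rw [real_inner_smul_left, real_inner_smul_right, inv_mul_cancel_left₀ hτ.ne']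
  simp only [h2] at this
  rw [this, Complex.real_smul]
  push_cast
  rfl

/-- The exponent is 3 - s - 3/2: the Fourier transform contributes τ³, the weight τ^{-s}, and the L²
norm of the dilated transform τ^{-3/2}. -/
theorem homNorm_scale (s : ℝ) (f : E3 → ℝ) {c τ : ℝ} (hc : 0 ≤ c) (hτ : 0 < τ) :
    homNorm s (fun x => c * f (τ⁻¹ • x))
      = ENNReal.ofReal (c * τ ^ (3 / 2 - s)) * homNorm s f := by
  have h1 : ∀ ξ : E3, ((‖ξ‖ ^ s : ℝ) : ℂ) * 𝓕 (fun x : E3 => ((c * f (τ⁻¹ • x) : ℝ) : ℂ)) ξ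
      = (c * τ ^ (3 - s)) • (((‖τ • ξ‖ ^ s : ℝ) : ℂ) * 𝓕 (fun x : E3 => (f x : ℂ)) (τ • ξ)) := by
    intro ξ
    have h2 : 𝓕 (fun x : E3 => ((c * f (τ⁻¹ • x) : ℝ) : ℂ)) ξ
        = (c : ℂ) * ((τ : ℂ) ^ 3 * 𝓕 (fun x : E3 => (f x : ℂ)) (τ • ξ)) := by
      rw [← fourier_scale (fun x : E3 => (f x : ℂ)) hτ, Real.fourier_eq, Real.fourier_eq,
        ← integral_const_mul]
      refine integral_congr_ae (.of_forall fun x => ?_)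
      simp only [Complex.ofReal_mul]
      rw [Circle.smul_def, Circle.smul_def, smul_eq_mul, smul_eq_mul]
      ring
    rw [h2, norm_smul, Real.norm_of_nonneg hτ.le, Real.mul_rpow hτ.le (norm_nonneg _),
      Real.rpow_sub hτ, Complex.real_smul]
    have h3 : (τ : ℂ) ^ 3 = ((τ ^ (3 : ℝ) : ℝ) : ℂ) := by
      rw [show (3 : ℝ) = ((3 : ℕ) : ℝ) by norm_num, Real.rpow_natCast]; push_cast; rfl
    have h4 : ((τ ^ s : ℝ) : ℂ) ≠ 0 := by
      exact_mod_cast (Real.rpow_pos_of_pos hτ s).ne'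
    rw [h3]
    push_cast
    field_simp
  rw [homNorm, homNorm]
  simp only [h1]
  change eLpNorm ((c * τ ^ (3 - s)) • fun ξ : E3 =>
    ((‖τ • ξ‖ ^ s : ℝ) : ℂ) * 𝓕 (fun x : E3 => (f x : ℂ)) (τ • ξ)) 2 volume = _
  rw [eLpNorm_const_smul, eLpNorm_comp_smul (fun ξ : E3 =>
    ((‖ξ‖ ^ s : ℝ) : ℂ) * 𝓕 (fun x : E3 => (f x : ℂ)) ξ) hτ, ← mul_assoc,
    Real.enorm_of_nonneg (by positivity), ← ENNReal.ofReal_mul (by positivity), mul_assoc c,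
    ← Real.rpow_add hτ]
  congr 4
  ring

theorem eLpNorm_scale (f : E3 → ℝ) {c τ : ℝ} (hc : 0 ≤ c) (hτ : 0 < τ) :
    eLpNorm (fun x => c * f (τ⁻¹ • x)) 2 volume
      = ENNReal.ofReal (c * τ ^ (3 / 2 : ℝ)) * eLpNorm f 2 volume := by
  change eLpNorm (c • fun x => f (τ⁻¹ • x)) 2 volume = _
  rw [eLpNorm_const_smul, eLpNorm_comp_smul f (inv_pos.2 hτ), ← mul_assoc,
    Real.enorm_of_nonneg hc, ← ENNReal.ofReal_mul hc, Real.inv_rpow hτ.le, ← Real.rpow_neg hτ.le,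
    neg_neg]

/-- Near the origin |ξ|^{2s} is integrable in dimension three because 2s > -3. Outside the unit ball
the weight is at most 1 and the transform is a Schwartz function. -/
theorem homNorm_lt_top {s : ℝ} (hs : -(3 / 2) < s) (hs0 : s ≤ 0) {f : E3 → ℝ}
    (hf : ContDiff ℝ ∞ f) (hc : HasCompactSupport f) : homNorm s f < ⊤ := by
  have hfc : ContDiff ℝ ∞ fun x : E3 => (f x : ℂ) := Complex.ofRealCLM.contDiff.comp hf
  have hcc : HasCompactSupport fun x : E3 => (f x : ℂ) := hc.comp_left (g := ((↑) : ℝ → ℂ)) rfl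
  set Φ : SchwartzMap E3 ℂ := 𝓕 (hcc.toSchwartzMap hfc) with hΦ
  have hΦe : ∀ ξ, Φ ξ = 𝓕 (fun x : E3 => (f x : ℂ)) ξ := fun ξ => rfl
  obtain ⟨B, hB⟩ : ∃ B, ∀ ξ, ‖Φ ξ‖ ≤ B := by
    obtain ⟨B, -, hB⟩ := Φ.decay 0 0
    exact ⟨B, fun ξ => by simpa using hB ξ⟩
  rw [homNorm]
  simp only [← hΦe]
  set g : E3 → ℂ := fun ξ => ((‖ξ‖ ^ s : ℝ) : ℂ) * Φ ξ with hg
  have hB0 : 0 ≤ B := (norm_nonneg _).trans (hB 0)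
  have hgn : ∀ ξ, ‖g ξ‖ = ‖ξ‖ ^ s * ‖Φ ξ‖ := fun ξ => by
    rw [hg, norm_mul, Complex.norm_real, Real.norm_of_nonneg (by positivity)]
  have hmeas : AEStronglyMeasurable g volume := by
    refine AEStronglyMeasurable.mul ?_ Φ.continuous.aestronglyMeasurable
    exact (Complex.measurable_ofReal.comp
      (measurable_norm.pow_const s)).aestronglyMeasurable
  have hin : MemLp ((Metric.ball (0 : E3) 1).indicator g) 2 volume := by
    rw [memLp_indicator_iff_restrict Metric.isOpen_ball.measurableSet,
      memLp_two_iff_integrable_sq_norm hmeas.restrict]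
    refine integrableOn_ball_of_norm_le_rpow (C := B ^ 2) (α := -(2 * s)) (by simp)
      (by simp; linarith) (.of_forall fun ξ => ?_) (hmeas.norm.pow 2)
    rw [hgn, neg_neg, Real.norm_of_nonneg (by positivity), mul_pow, mul_comm, two_mul]
    refine mul_le_mul (by gcongr; exact hB ξ) (le_of_eq ?_) (by positivity) (by positivity)
    rw [← Real.rpow_natCast, ← Real.rpow_mul (norm_nonneg _)]
    congr 1
    push_cast
    ring
  have hout : MemLp ((Metric.ball (0 : E3) 1)ᶜ.indicator g) 2 volume := by
    refine (Φ.memLp 2 volume).mono (hmeas.indicator Metric.isOpen_ball.measurableSet.compl)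
      (.of_forall fun ξ => ?_)
    by_cases hξ : ξ ∈ (Metric.ball (0 : E3) 1)ᶜ
    · rw [indicator_of_mem hξ, hgn]
      have h1 : 1 ≤ ‖ξ‖ := by simpa using hξ
      exact mul_le_of_le_one_left (norm_nonneg _) (Real.rpow_le_one_of_one_le_of_nonpos h1 hs0)
    · rw [indicator_of_notMem hξ]; simp
  have := (hin.add hout).2
  rwa [indicator_self_add_compl] at this

/-! ### The vector fields -/

theorem pd_scale (i : Fin 3) (f : E3 → ℝ) (c τ : ℝ) :
    pd i (fun x => c * f (τ⁻¹ • x)) = fun x => c * τ⁻¹ * pd i f (τ⁻¹ • x) := by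
  ext x
  have h1 : (fun x : E3 => c * f (τ⁻¹ • x)) = c • fun x => f (τ⁻¹ • x) := rfl
  rw [pd, h1, fderiv_const_smul_field, Pi.smul_apply, fderiv_comp_smul]
  simp [pd, mul_assoc]

/-- Rotations commute with dilations and each partial derivative gains τ⁻¹ ≤ 1, so no field makes
the dilated data larger. -/
theorem fields_scale (f : E3 → ℝ) {τ : ℝ} (hτ : 1 ≤ τ) {c : ℝ} (hc : 0 ≤ c)
    (γ : List (Fin 3 ⊕ Fin 3)) : ∃ c', 0 ≤ c' ∧ c' ≤ c ∧
      fields γ (fun x => c * f (τ⁻¹ • x)) = fun x => c' * fields γ f (τ⁻¹ • x) := by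
  have hτ0 : τ ≠ 0 := by linarith
  induction γ with
  | nil => exact ⟨c, hc, le_rfl, rfl⟩
  | cons Z γ ih =>
    obtain ⟨c', h0, h1, h2⟩ := ih
    rcases Z with i | i
    · refine ⟨c' * τ⁻¹, by positivity,
        (mul_le_of_le_one_right h0 (inv_le_one_of_one_le₀ hτ)).trans h1, ?_⟩
      simp only [fields, h2, field, pd_scale]
    · refine ⟨c', h0, h1, ?_⟩
      simp only [fields, h2, field, pd_scale]
      ext x
      simp only [PiLp.smul_apply, smul_eq_mul]
      field_simp

theorem pd_contDiff (i : Fin 3) {f : E3 → ℝ} (hf : ContDiff ℝ ∞ f) : ContDiff ℝ ∞ (pd i f) :=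
  (hf.fderiv_right (m := ∞) le_rfl).clm_apply contDiff_const

theorem tsupport_pd_subset (i : Fin 3) (f : E3 → ℝ) : tsupport (pd i f) ⊆ tsupport f :=
  tsupport_fderiv_apply_subset ℝ _

theorem fields_contDiff {f : E3 → ℝ} (hf : ContDiff ℝ ∞ f) (γ : List (Fin 3 ⊕ Fin 3)) :
    ContDiff ℝ ∞ (fields γ f) := by
  induction γ with
  | nil => exact hf
  | cons Z γ ih =>
    have hx : ∀ i : Fin 3, ContDiff ℝ ∞ fun x : E3 => x i := fun i =>
      (EuclideanSpace.proj (𝕜 := ℝ) i).contDiff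
    rcases Z with i | i
    · exact pd_contDiff i ih
    · exact ((hx _).mul (pd_contDiff _ ih)).sub ((hx _).mul (pd_contDiff _ ih))

theorem support_fields_subset (f : E3 → ℝ) (γ : List (Fin 3 ⊕ Fin 3)) :
    tsupport (fields γ f) ⊆ tsupport f := by
  induction γ with
  | nil => exact le_rfl
  | cons Z γ ih =>
    rcases Z with i | i
    · exact (tsupport_pd_subset i _).trans ih
    · refine closure_minimal (fun x hx => ?_) (isClosed_tsupport _)
      by_contra h0
      have : ∀ j, pd j (fields γ f) x = 0 := fun j => by
        by_contra h1
        exact h0 (ih (tsupport_pd_subset j _ (subset_tsupport _ h1)))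
      exact hx (by simp [fields, field, this])

theorem fields_zero (γ : List (Fin 3 ⊕ Fin 3)) : fields γ (fun _ => 0) = fun _ => 0 := by
  induction γ with
  | nil => rfl
  | cons Z γ ih =>
    ext x
    rcases Z with i | i <;> simp [fields, field, ih, pd]

theorem homNorm_zero (s : ℝ) : homNorm s (fun _ => 0) = 0 := by
  have : 𝓕 (fun _ : E3 => (0 : ℂ)) = fun _ => 0 := by
    ext ξ; simp [Real.fourier_eq]
  simp [homNorm, this]

theorem farNorm_zero (p : ℝ) (ψ : ℝ → ℝ) (R : ℝ) : farNorm p ψ R (fun _ => 0) = 0 := by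
  simp [farNorm, fields_zero, homNorm_zero]

theorem hNorm_zero (k : ℕ) : hNorm k (fun _ => 0) = 0 := by
  have : ∀ n, iteratedFDeriv ℝ n (fun _ : E3 => (0 : ℝ)) = 0 := fun n => iteratedFDeriv_fun_zero
  simp [hNorm, this]

/-- The norm of the data at the scale `τ`, far from the black hole. -/
theorem exists_xNorm_le {p R : ℝ} (hp : 1 < p) (hR : 0 < R) {ψ : ℝ → ℝ} (hψ : IsCutoff ψ)
    {g : E3 → ℝ} (hg : ContDiff ℝ ∞ g) (hgs : ∀ x, g x ≠ 0 → 1 ≤ ‖x‖ ∧ ‖x‖ ≤ 2) {A : ℝ}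
    (hA : 0 < A) :
    ∃ B > 0, ∀ τ, 1 ≤ τ → 4 * R < τ → ∀ u₀ u₁ : E3 → ℝ, (∀ x, u₀ x = 0) →
      (∀ x, u₁ x = A * τ ^ (-2 / (p - 1) - 1) * g (τ⁻¹ • x)) →
      xNorm p ψ R u₀ u₁ ≤ ENNReal.ofReal (B * τ ^ (1 + 1 / p - 2 / (p - 1))) := by
  have hp0 : 0 < p := by linarith
  have hs1 : -(3 / 2) < sd p - 1 := by
    have : 1 / p < 1 := (div_lt_one hp0).2 hp
    unfold sd; linarith
  have hs2 : sd p - 1 ≤ 0 := by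
    have : 0 < 1 / p := by positivity
    unfold sd; linarith
  have hgc : HasCompactSupport g :=
    HasCompactSupport.of_support_subset_isCompact (shell_isCompact 1 2) hgs
  set 𝔅 : ℝ≥0∞ := ∑ n ∈ Finset.range 3, ∑ γ : Fin n → Fin 3 ⊕ Fin 3,
    (eLpNorm (fields (List.ofFn γ) g) 2 volume + homNorm (sd p - 1) (fields (List.ofFn γ) g))
    with h𝔅
  have hfin : 𝔅 ≠ ⊤ := by
    refine (ENNReal.sum_lt_top.2 fun n _ => ENNReal.sum_lt_top.2 fun γ _ => ?_).ne
    have h1 := fields_contDiff hg (List.ofFn γ)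
    have h2 : HasCompactSupport (fields (List.ofFn γ) g) :=
      hgc.of_isClosed_subset (isClosed_tsupport _) (support_fields_subset g _)
    exact ENNReal.add_lt_top.2 ⟨(h1.continuous.memLp_of_hasCompactSupport h2).2,
      homNorm_lt_top hs1 hs2 h1 h2⟩
  refine ⟨A * (𝔅.toReal + 1), by positivity, fun τ hτ1 hτ u₀ u₁ hu₀ hu₁ => ?_⟩
  have hτ0 : 0 < τ := by linarith
  set c := A * τ ^ (-2 / (p - 1) - 1) with hc
  have hc0 : 0 ≤ c := by positivity
  obtain rfl : u₀ = fun _ => 0 := funext hu₀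
  obtain rfl : u₁ = fun x => c * g (τ⁻¹ • x) := funext hu₁
  have hsupp : tsupport (fun x => c * g (τ⁻¹ • x)) ⊆ {x | τ ≤ ‖x‖ ∧ ‖x‖ ≤ 2 * τ} := by
    refine shell_tsupport_subset fun x hx => ?_
    have := hgs _ (right_ne_zero_of_mul hx)
    rw [norm_smul, norm_inv, Real.norm_of_nonneg hτ0.le, inv_mul_eq_div, le_div_iff₀ hτ0,
      div_le_iff₀ hτ0, one_mul] at this
    exact this
  -- The data live at r ≥ τ > 4R, where the near cutoff vanishes and the far cutoff equals 1.
  have hnear : (fun x : E3 => (1 - ψ (‖x‖ / (2 * R))) * (c * g (τ⁻¹ • x))) = fun _ => 0 := by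
    ext x
    by_cases hx : c * g (τ⁻¹ • x) = 0
    · rw [hx, mul_zero]
    · have := (hsupp (subset_tsupport _ hx)).1
      rw [hψ.2.2 _ ((lt_div_iff₀ (by positivity)).2 (by linarith)), sub_self, zero_mul]
  have hfar : ∀ γ, (fun x : E3 => ψ (‖x‖ / R) * fields γ (fun x => c * g (τ⁻¹ • x)) x)
      = fields γ (fun x => c * g (τ⁻¹ • x)) := by
    intro γ
    ext x
    by_cases hx : fields γ (fun x => c * g (τ⁻¹ • x)) x = 0
    · rw [hx, mul_zero]
    · have := (hsupp (support_fields_subset _ γ (subset_tsupport _ hx))).1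
      rw [hψ.2.2 _ ((lt_div_iff₀ hR).2 (by linarith)), one_mul]
  have hpd : ∀ i, pd i (fun _ : E3 => (0 : ℝ)) = fun _ => 0 := fun i => by
    ext x; simp [pd]
  simp only [xNorm, mul_zero, hnear, hNorm_zero, hpd, farNorm_zero, Finset.sum_const_zero, zero_add]
  set e := 1 + 1 / p - 2 / (p - 1) with he
  have hpow : c * τ ^ (3 / 2 - (sd p - 1)) = A * τ ^ e := by
    rw [hc, mul_assoc, ← Real.rpow_add hτ0]
    congr 2
    rw [he, sd]; ring
  calc farNorm p ψ R (fun x => c * g (τ⁻¹ • x))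
      ≤ ∑ n ∈ Finset.range 3, ∑ γ : Fin n → Fin 3 ⊕ Fin 3, ENNReal.ofReal (A * τ ^ e) *
        (eLpNorm (fields (List.ofFn γ) g) 2 volume
          + homNorm (sd p - 1) (fields (List.ofFn γ) g)) := by
        rw [farNorm]
        refine Finset.sum_le_sum fun n _ => Finset.sum_le_sum fun γ _ => ?_
        rw [hfar]
        obtain ⟨c', h0, h1, h2⟩ := fields_scale g hτ1 hc0 (List.ofFn γ)
        -- The L² norm scales with exponent 3/2 only. As s_d - 1 ≤ 0 and τ ≥ 1, the Ḣ^{s_d-1}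
        -- exponent dominates.
        rw [h2, eLpNorm_scale _ h0 hτ0, homNorm_scale _ _ h0 hτ0, mul_add, ← hpow]
        gcongr
        linarith
    _ = ENNReal.ofReal (A * τ ^ e) * 𝔅 := by
        simp only [h𝔅, Finset.mul_sum]
    _ ≤ ENNReal.ofReal (A * τ ^ e) * ENNReal.ofReal (𝔅.toReal + 1) := by
        gcongr
        rw [ENNReal.le_ofReal_iff_toReal_le hfin (by positivity)]
        linarith
    _ = _ := by
        rw [← ENNReal.ofReal_mul (by positivity)]
        congr 1
        ring

theorem exists_shellProfile (n : ℕ) (hn : 1 ≤ n) :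
    ∃ (χ h₁ h₂ : ℝ → ℝ) (C : ℝ), (∀ r, 0 ≤ χ r) ∧ (∀ r, χ r ≤ 1) ∧ 0 ≤ C ∧
      IsShellProfile (fun r => χ r ^ (n + 2)) h₁ h₂ 1 2 ∧ (∀ r, |h₁ r| ≤ C * χ r ^ n) ∧
      (∀ r, |h₂ r| ≤ C * χ r ^ n) ∧ χ (3 / 2) ≠ 0 := by
  set χ : ContDiffBump (3 / 2 : ℝ) := ⟨1 / 4, 1 / 2, by norm_num, by norm_num⟩ with hχ
  have hsupp : ∀ r, χ r ≠ 0 → 1 ≤ r ∧ r ≤ 2 := by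
    intro r hr
    have : r ∈ Function.support χ := hr
    rw [χ.support_eq, Metric.mem_ball, Real.dist_eq, abs_lt] at this
    simp only [hχ] at this
    constructor <;> linarith
  obtain ⟨h₁, h₂, C, hs₁, hC, hd, hd₁, hb₁, hb₂⟩ := contDiff_pow_profile (χ := χ) χ.contDiff
    χ.hasCompactSupport (fun r => χ.nonneg' r) (fun r => χ.le_one) n
  refine ⟨χ, h₁, h₂, C, fun r => χ.nonneg' r, fun r => χ.le_one, hC,
    ⟨one_pos, χ.contDiff.pow _, hs₁, hd, hd₁, fun r hr => hsupp r fun h0 => hr (by simp [h0]),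
      fun r hr => hsupp r fun h0 => hr ?_⟩, hb₁, hb₂, ?_⟩
  -- Since n ≥ 1, the bound C χ^n vanishes wherever χ does, so the derivative has the same support
  -- bounds.
  · have := hb₁ r
    rw [h0, zero_pow (by omega), mul_zero] at this
    exact abs_nonpos_iff.1 this
  · rw [χ.one_of_mem_closedBall (by simp [hχ])]
    exact one_ne_zero

/-- If κ > N, then c ≤ C ε^{κ-N} → 0 as ε → 0, contradicting c > 0. -/
theorem le_of_forall_rpow_le {N κ c C ε₀ : ℝ} (hc : 0 < c) (hε₀ : 0 < ε₀)
    (h : ∀ ε, 0 < ε → ε < ε₀ → c * ε ^ (-κ) ≤ C * ε ^ (-N)) : κ ≤ N := by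
  by_contra! hlt
  have hδ : 0 < κ - N := by linarith
  have h1 : Tendsto (fun ε : ℝ => C * ε ^ (κ - N)) (𝓝[>] 0) (𝓝 (C * 0 ^ (κ - N))) :=
    (((Real.continuousAt_rpow_const 0 (κ - N) (Or.inr hδ.le)).tendsto).const_mul C).mono_left
      nhdsWithin_le_nhds
  rw [Real.zero_rpow hδ.ne', mul_zero] at h1
  refine absurd (ge_of_tendsto h1 ?_) (not_le.2 hc)
  filter_upwards [Ioo_mem_nhdsGT hε₀] with ε hε
  have h2 := h ε hε.1 hε.2
  have h3 : c * ε ^ (-κ) * ε ^ κ ≤ C * ε ^ (-N) * ε ^ κ :=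
    mul_le_mul_of_nonneg_right h2 (Real.rpow_nonneg hε.1.le _)
  rw [mul_assoc, mul_assoc, ← Real.rpow_add hε.1, ← Real.rpow_add hε.1, neg_add_cancel,
    Real.rpow_zero, mul_one] at h3
  rwa [show κ - N = -N + κ by ring]

end Kerr

end
-- Matching the scale τ to the size ε.
theorem theorem1p2 (p : ℝ) (hp : 1 < p) (hp' : p < 1 + Real.sqrt 2)
    (a M R : ℝ) (ha : 0 ≤ a) (haM : a ≤ M) (hR : 3 * M < R)
    (ψ : ℝ → ℝ) (hψ : Kerr.IsCutoff ψ) (S : Kerr.Slicing a M R) :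
    (∃ C > 0, ∃ ε₀ > 0, ∀ ε : ℝ, 0 < ε → ε < ε₀ →
      (∃ u₀ u₁ : 𝓓(Kerr.outside (4 * R), ℝ),
        Kerr.xNorm p ψ R u₀ u₁ ≤ ENNReal.ofReal ε ∧
        S.lifespan p u₀ u₁ ≤ ENNReal.ofReal (C * ε ^ (-(p * (p - 1) / (1 + 2 * p - p ^ 2))))) ∧
      S.lifespanOfSize p ψ ε ≤
        ENNReal.ofReal (C * ε ^ (-(p * (p - 1) / (1 + 2 * p - p ^ 2))))) ∧
    (∀ κ : ℝ,
      (∃ c > 0, ∃ ε₁ > 0, ∀ ε : ℝ, 0 < ε → ε < ε₁ →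
        ENNReal.ofReal (c * ε ^ (-κ)) ≤ S.lifespanOfSize p ψ ε) →
      κ ≤ p * (p - 1) / (1 + 2 * p - p ^ 2)) := by

  have hR0 : 0 < R := by linarith
  have hp0 : 0 < p := by linarith
  have hp1 : 0 < p - 1 := by linarith
  have hden : 0 < 1 + 2 * p - p ^ 2 := by
    have h2 : (p - 1) ^ 2 < Real.sqrt 2 ^ 2 :=
      pow_lt_pow_left₀ (by linarith) hp1.le two_ne_zero
    rw [Real.sq_sqrt (by norm_num)] at h2
    linarith
  set N := p * (p - 1) / (1 + 2 * p - p ^ 2) with hN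
  have hN0 : 0 < N := by positivity
  have hmain : ∃ C > 0, ∃ ε₀ > 0, ∀ ε : ℝ, 0 < ε → ε < ε₀ →
      (∃ u₀ u₁ : 𝓓(Kerr.outside (4 * R), ℝ),
        Kerr.xNorm p ψ R u₀ u₁ ≤ ENNReal.ofReal ε ∧
        S.lifespan p u₀ u₁ ≤ ENNReal.ofReal (C * ε ^ (-N))) ∧
      S.lifespanOfSize p ψ ε ≤ ENNReal.ofReal (C * ε ^ (-N)) := by
    -- n ≥ 2/(p-1) is equivalent to (n+2)/p ≤ n.
    obtain ⟨n, hn⟩ := exists_nat_ge (2 / (p - 1))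
    have hn1 : 1 ≤ n := by
      have : 0 < 2 / (p - 1) := by positivity
      exact_mod_cast (this.trans_le hn)
    have hnp : ((n : ℝ) + 2) / p ≤ n := by
      rw [div_le_iff₀ hp1] at hn
      rw [div_le_iff₀ hp0]
      linarith
    obtain ⟨χ, h₁, h₂, C, hχ0, hχ1, hC, H, hb₁, hb₂, hne⟩ := Kerr.exists_shellProfile n hn1
    obtain ⟨A, hA, hlife⟩ :=
      S.exists_lifespan_le ha haM hR hp hnp hχ0 hχ1 hC H hb₁ hb₂ hne
    obtain ⟨B, hB, hnorm⟩ := Kerr.exists_xNorm_le hp hR0 hψ H.contDiff_norm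
      (fun x hx => H.supp ‖x‖ hx) hA
    -- With τ = (B/ε)^N, the threshold on ε says exactly τ > 1 + 4R, which covers both τ ≥ 1 and τ >
    -- 4R.
    refine ⟨B ^ N, by positivity, B / (1 + 4 * R) ^ N⁻¹, by positivity, fun ε hε hε₀ => ?_⟩
    have hτe : B ^ N * ε ^ (-N) = (B / ε) ^ N := by
      rw [Real.div_rpow hB.le hε.le, Real.rpow_neg hε.le, div_eq_mul_inv]
    rw [hτe]
    set τ := (B / ε) ^ N with hτ
    have hτ1 : 1 + 4 * R < τ := by
      rw [lt_div_comm₀ hε (by positivity)] at hε₀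
      rwa [hτ, ← Real.rpow_inv_lt_iff_of_pos (by positivity) (by positivity) hN0]
    have hτ0 : 0 < τ := by positivity
    have hBτ : B * τ ^ (1 + 1 / p - 2 / (p - 1)) = ε := by
      -- The exponent N is born here: the norm of the data at scale τ is at most B τ^{-1/N}.
      have : 1 + 1 / p - 2 / (p - 1) = -N⁻¹ := by
        rw [hN]; field_simp; ring
      rw [this, Real.rpow_neg hτ0.le, hτ, Real.rpow_rpow_inv (by positivity) hN0.ne', inv_div,
        mul_div_cancel₀ _ hB.ne']
    have hsc : ∀ x : E3, ‖τ⁻¹ • x‖ = ‖x‖ / τ := fun x => by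
      rw [norm_smul, norm_inv, Real.norm_of_nonneg hτ0.le, inv_mul_eq_div]
    have Hτ := H.scale hτ0
    have hf : ContDiff ℝ ∞ fun x : E3 =>
        A * τ ^ (-2 / (p - 1) - 1) * χ (‖x‖ / τ) ^ (n + 2) :=
      contDiff_const.mul Hτ.contDiff_norm
    have hfs : ∀ x : E3, A * τ ^ (-2 / (p - 1) - 1) * χ (‖x‖ / τ) ^ (n + 2) ≠ 0 →
        1 * τ ≤ ‖x‖ ∧ ‖x‖ ≤ 2 * τ := fun x hx => Hτ.supp ‖x‖ (right_ne_zero_of_mul hx)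
    have hx : ∀ u₀ u₁ : E3 → ℝ, (∀ x, u₀ x = 0) →
        (∀ x, u₁ x = A * τ ^ (-2 / (p - 1) - 1) * χ (‖x‖ / τ) ^ (n + 2)) →
        Kerr.xNorm p ψ R u₀ u₁ ≤ ENNReal.ofReal ε := fun u₀ u₁ h0 h1 => by
      rw [← hBτ]
      exact hnorm τ (by linarith) (by linarith) u₀ u₁ h0 fun x => by rw [h1, hsc]
    have hl := fun u₀ u₁ => hlife τ (by linarith) u₀ u₁
    refine ⟨⟨0, Kerr.shellTest hf hfs (by linarith), hx _ _ (fun _ => rfl) fun _ => rfl,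
      hl _ _ (fun _ => rfl) fun _ => rfl⟩, ?_⟩
    have hr₀ := S.r₀_lt ha haM hR
    refine (iInf₂_le (0 : 𝓓(Kerr.outside S.r₀, ℝ))
      (Kerr.shellTest hf hfs (by linarith : S.r₀ < 1 * τ))).trans ?_
    exact (iInf_le _ (hx _ _ (fun _ => rfl) fun _ => rfl)).trans
      (hl _ _ (fun _ => rfl) fun _ => rfl)
  refine ⟨hmain, fun κ ⟨c, hc, ε₁, hε₁, hκ⟩ => ?_⟩
  obtain ⟨C, hC, ε₀, hε₀, h⟩ := hmain
  refine Kerr.le_of_forall_rpow_le (C := C) hc (lt_min hε₀ hε₁) fun ε h0 h1 => ?_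
  have := (hκ ε h0 (h1.trans_le (min_le_right _ _))).trans (h ε h0 (h1.trans_le (min_le_left _ _))).2
  rwa [ENNReal.ofReal_le_ofReal_iff (by positivity)] at this
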